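/- **Theorem 1.3.** *Model.* The input is a simple undirected graph $G=(V,E)$ without isolated vertices, with $n=|V|\ge 1$ vertices and average degree $d=2|E|/n$. Its vertices carry arbitrary distinct identifiers from $\mathbb N$; the graph and $n$ are unknown, and vertices are accessed through their identifiers. A randomized adaptive algorithm makes queries at unit cost and outputs a real number. The base model with random edges has the queries RandVert() (a uniformly random vertex), RandEdge() (a uniformly random edge), RandNbr($x$) (a uniformly random neighbor of $x$) and Degree($x$). The full adjacency model with random edges additionally has Pair($x,y$) (whether $\{x,y\}\in E$) and FullNbrHood($x$) (the set of all neighbors of $x$). (a) There are constants $C>0$ and $p\in\mathbb N$ such that for every $\varepsilon\in(0,1)$ there is an algorithm in the base model with random edges, which queries only vertices returned by its earlier queries, such that for every input graph, with probability greater than $0.99$, the algorithm outputs some $\hat d$ with $|\hat d-d|\le\varepsilon d$ after at most $$C\,(1+\log n)^{p}\;\varepsilon^{-2}\min\bigl(d,\sqrt{n/d}\bigr)$$ queries, that is, $\widetilde O(\varepsilon^{-2}\min(d,\sqrt{n/d}))$ queries. In particular, for the same algorithm, with probability greater than $0.99$ it outputs such a $\hat d$ after at most $C\,(1+\log n)^{p}\,\varepsilon^{-2}n^{1/3}$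 queries. (b) For every $c\ge 1$ there are $\kappa>0$ and $n_0\in\mathbb N$ such that the following holds. Let an algorithm in the full adjacency model with random edges output, for every input graph, with probability greater than $2/3$, some $\hat d$ with $d/c\le\hat d\le c\,d$. Then for every $n\ge n_0$ there is an input graph with $n$ vertices on which, with probability at least $1/4$, the algorithm makes more than $\kappa\, n^{1/3}$ queries. So every constant-factor approximation of $d$ requires $\Omega(n^{1/3})$ queries, even with full adjacency access and random edges. -/

import Mathlib

open scoped ENNReal

noncomputable section

/-- An input graph: a simple undirected graph on `n ≥ 1` vertices without isolated vertices, whose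
vertices carry distinct identifiers from the unbounded universe `ℕ`. An algorithm only ever sees
identifiers, so that an identifier by itself says nothing about `n`. -/
structure InputGraph where
  n : ℕ
  n_pos : 0 < n
  graph : SimpleGraph (Fin n)
  no_isolated : ∀ v, ∃ w, graph.Adj v w
  id : Fin n ↪ ℕ

namespace InputGraph

instance (G : InputGraph) : Nonempty (Fin G.n) := ⟨⟨0, G.n_pos⟩⟩

open Classical in
theorem neighborFinset_nonempty (G : InputGraph) (v : Fin G.n) :
    (G.graph.neighborFinset v).Nonempty := by
  obtain ⟨w, hw⟩ := G.no_isolated v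
  exact ⟨w, by simpa using hw⟩

open Classical in
theorem edgeFinset_nonempty (G : InputGraph) : G.graph.edgeFinset.Nonempty := by
  obtain ⟨w, hw⟩ := G.no_isolated ⟨0, G.n_pos⟩
  exact ⟨s(⟨0, G.n_pos⟩, w), by simpa using hw⟩

/-- The average degree `d = 2m / n`. -/
def avgDeg (G : InputGraph) : ℝ := by
  classical exact 2 * (G.graph.edgeFinset.card : ℝ) / (G.n : ℝ)

/-- The vertex with identifier `x`, or `none` if `x` is not the identifier of a vertex. -/
def vertex (G : InputGraph) (x : ℕ) : Option (Fin G.n) := Function.partialInv G.id x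

end InputGraph

/-- The oracle queries; vertices are named by their identifiers. -/
inductive Query where
  | randVert : Query
  | randEdge : Query
  | randNbr (x : ℕ) : Query
  | degree (x : ℕ) : Query
  | pair (x y : ℕ) : Query
  | fullNbrHood (x : ℕ) : Query

namespace Query

/-- The type of answers to a query. The answer `none` means that the queried identifier does not
belong to a vertex. -/
def Response : Query → Type
  | randVert => ℕ
  | randEdge => Sym2 ℕ
  | randNbr _ => Option ℕ
  | degree _ => Option ℕ
  | pair _ _ => Bool
  | fullNbrHood _ => Option (Finset ℕ)

/-- The queries of the base model together with random edge samples. -/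
def IsBaseOrRandEdge : Query → Prop
  | randVert => True
  | randEdge => True
  | randNbr _ => True
  | degree _ => True
  | pair _ _ => False
  | fullNbrHood _ => False

/-- The identifiers that a query is about. -/
def ids : Query → Finset ℕ
  | randVert => ∅
  | randEdge => ∅
  | randNbr x => {x}
  | degree x => {x}
  | pair x y => {x, y}
  | fullNbrHood x => {x}

/-- The identifiers revealed by the answer to a query. -/
def revealed : (q : Query) → q.Response → Finset ℕ
  | randVert, r => ({r} : Finset ℕ)
  | randEdge, r => Sym2.toFinset (r : Sym2 ℕ)
  | randNbr _, r => Option.toFinset (r : Option ℕ)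
  | degree _, _ => ∅
  | pair _ _, _ => ∅
  | fullNbrHood _, r => Option.getD (r : Option (Finset ℕ)) ∅

end Query

open Classical in
/-- The distribution of the answer that the oracles of `G` give to a query; different calls use
independent randomness. -/
def InputGraph.answer (G : InputGraph) : (q : Query) → PMF q.Response
  | .randVert => (PMF.uniformOfFintype (Fin G.n)).map G.id
  | .randEdge =>
      (PMF.uniformOfFinset G.graph.edgeFinset G.edgeFinset_nonempty).map (Sym2.map G.id)
  | .randNbr x =>
      match G.vertex x with
      | none => PMF.pure (none : Option ℕ)
      | some v =>
          (PMF.uniformOfFinset (G.graph.neighborFinset v) (G.neighborFinset_nonempty v)).map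
            (fun w => (some (G.id w) : Option ℕ))
  | .degree x => PMF.pure ((G.vertex x).map (fun v => G.graph.degree v) : Option ℕ)
  | .pair x y =>
      PMF.pure (decide (∃ u v, G.id u = x ∧ G.id v = y ∧ G.graph.Adj u v) : Bool)
  | .fullNbrHood x =>
      PMF.pure ((G.vertex x).map (fun v => (G.graph.neighborFinset v).map G.id) :
        Option (Finset ℕ))

/-- A randomized adaptive query algorithm that outputs a real number. In each state it either stops
with an output, or makes a query and moves on to a random next state that depends on the answer.
It is not given the graph nor its number of vertices. -/
structure QueryAlgorithm where
  State : Type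
  init : PMF State
  next : State → ((q : Query) × (q.Response → PMF State)) ⊕ ℝ

namespace QueryAlgorithm

/-- Run `A` from state `s` on `G` with at most `k` further queries: the result is `some x` if `A`
stops with output `x`, and `none` if it wants to make more than `k` queries. -/
def runFrom (A : QueryAlgorithm) (G : InputGraph) : ℕ → A.State → PMF (Option ℝ)
  | 0, s =>
      match A.next s with
      | .inr x => PMF.pure (some x)
      | .inl _ => PMF.pure none
  | k + 1, s =>
      match A.next s with
      | .inr x => PMF.pure (some x)
      | .inl ⟨q, f⟩ => (G.answer q).bind fun r => (f r).bind fun s' => runFrom A G k s'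

/-- The probability that `A`, run on `G`, stops after at most `k` queries with an output in `S`. -/
def probWithin (A : QueryAlgorithm) (G : InputGraph) (k : ℕ) (S : Set ℝ) : ℝ≥0∞ :=
  (A.init.bind (A.runFrom G k)).toOuterMeasure (some '' S)

/-- The probability that `A`, run on `G`, stops with an output in `S`. -/
def prob (A : QueryAlgorithm) (G : InputGraph) (S : Set ℝ) : ℝ≥0∞ := ⨆ k, A.probWithin G k S

/-- `A.Reaches s K`: `A` can be in state `s` when `K` is the set of identifiers that the answers to
its queries have revealed so far. -/
inductive Reaches (A : QueryAlgorithm) : A.State → Finset ℕ → Prop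
  | init {s : A.State} : s ∈ A.init.support → Reaches A s ∅
  | step {s s' : A.State} {K : Finset ℕ} {q : Query} {f : q.Response → PMF A.State}
      (r : q.Response) : Reaches A s K → A.next s = .inl ⟨q, f⟩ → s' ∈ (f r).support →
      Reaches A s' (K ∪ q.revealed r)

/-- `A` works in the base model with random edge samples: it only makes queries of that model, and
only about vertices that were returned by earlier queries. -/
def InBaseModelWithRandEdge (A : QueryAlgorithm) : Prop :=
  ∀ (s : A.State) (K : Finset ℕ) (q : Query) (f : q.Response → PMF A.State),
    A.Reaches s K → A.next s = .inl ⟨q, f⟩ → q.IsBaseOrRandEdge ∧ q.ids ⊆ K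

end QueryAlgorithm

end

/-! Upper bound. Fix a scale `τ = 2 ^ j`. The mean over a random vertex of `min (deg / τ) 1` is `α =
∑ min(deg, τ) / (τ n)`. The mean over a random edge of the average of `min 1 (τ / deg)` over its
endpoints is `β = ∑ min(deg, τ) / (2m)`. Hence `d β = τ α` at every scale (`avgDeg_mul_edgeMean`),
and `d` can be read off from any scale at which both means can be estimated. They are estimated by
inverse sampling: sampling goes on until a sum of statistics reaches a threshold `U` of order `ε⁻²
(j + 1)(j + 2)`. The two crossing times are about `U / α` and `U / β`, so `τ` times their ratio is
about `d`. All scales are watched on the same samples, and the first one at which both sums have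
crossed decides the output, so no knowledge of `n` is needed. The thresholds grow with `j` so that
the failure probabilities sum to less than `1 / 100` (`lt_roundProb_stoppingRule`). Two scales bound
the cost. At `τ = 1` the means are `1` and `1 / d`, which costs about `d`. At `τ` of order `√(2m)`
there are too few vertices of degree above `τ` to carry most of the edges among themselves, so `β ≥
1 / 2` (`half_le_edgeMean`) and `α` is at least of order `√(d / n)`; this costs about `√(n / d)`
(`exists_scale`). Lower bound. A clique on about `n ^ (2/3)` vertices is joined with either `L` or
`L' = R n` disjoint edges, where `R ≥ c ^ 2` and the first graph has `n` vertices. The average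
degrees differ by a factor above `c ^ 2`. A random vertex is in the clique, or a random edge outside
it, with probability `O(n ^ (-1/3))`. The matching identifiers are a random subset of a much larger
universe, so they cannot be guessed. Thus `lazyAnswer`, which knows neither `L` nor `L'`, imitates
both graphs up to a loss of `1 - ρ = O(n ^ (-1/3))` per query. The comparison is a one-sided
minorization: `ρ ^ k` times the law of the lazy run is at most the averaged law of the true run
(`lazyRun_le`). Applying it to an event for one graph and to its complement for the other bounds `ρ
^ K` away from `1` (`pow_add_le_of_distinguishes`), which fails for `K` a small multiple of `n ^
(1/3)`. -/

/-! ### Averages over independent samples and Chebyshev's inequality -/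

section IidAverage

variable {Ω : Type*} [Fintype Ω]

/-- The expectation of `F` over lists of `k` independent uniform elements of `Ω`. -/
noncomputable def iidAvg : ℕ → (List Ω → ℝ) → ℝ
  | 0, F => F []
  | k + 1, F => (∑ z, iidAvg k (fun l => F (z :: l))) / Fintype.card Ω

theorem iidAvg_mono {k : ℕ} {F F' : List Ω → ℝ} (h : ∀ l, l.length = k → F l ≤ F' l) :
    iidAvg k F ≤ iidAvg k F' := by
  induction k generalizing F F' with
  | zero => exact h [] rfl
  | succ k ih =>
    simp only [iidAvg]
    gcongr with z
    exact ih fun l hl => h _ (by simp [hl])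

theorem iidAvg_add (k : ℕ) (F F' : List Ω → ℝ) :
    iidAvg k (fun l => F l + F' l) = iidAvg k F + iidAvg k F' := by
  induction k generalizing F F' with
  | zero => rfl
  | succ k ih => simp only [iidAvg, ih, Finset.sum_add_distrib, add_div]

theorem iidAvg_const_mul (k : ℕ) (c : ℝ) (F : List Ω → ℝ) :
    iidAvg k (fun l => c * F l) = c * iidAvg k F := by
  induction k generalizing F with
  | zero => rfl
  | succ k ih => simp only [iidAvg, ih, ← Finset.mul_sum, mul_div_assoc]

theorem iidAvg_const [Nonempty Ω] (k : ℕ) (c : ℝ) : iidAvg k (fun _ : List Ω => c) = c := by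
  induction k with
  | zero => rfl
  | succ k ih => simp [iidAvg, ih]

theorem iidAvg_sum [Nonempty Ω] {ι : Type*} (s : Finset ι) (k : ℕ) (F : ι → List Ω → ℝ) :
    iidAvg k (fun l => ∑ i ∈ s, F i l) = ∑ i ∈ s, iidAvg k (F i) := by
  classical
  induction s using Finset.induction_on with
  | empty => simp [iidAvg_const]
  | insert a s ha ih => simp only [Finset.sum_insert ha, iidAvg_add, ih]

/-- Coordinates beyond `t` average out, so Chebyshev at a fixed time applies inside a run of any
greater length. -/
theorem iidAvg_take [Nonempty Ω] {t k : ℕ} (h : t ≤ k) (F : List Ω → ℝ) :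
    iidAvg k (fun l => F (l.take t)) = iidAvg t F := by
  induction k generalizing t F with
  | zero => obtain rfl : t = 0 := by omega
            rfl
  | succ k ih =>
    cases t with
    | zero => exact iidAvg_const (Ω := Ω) (k + 1) (F [])
    | succ t =>
      simp only [iidAvg, List.take_succ_cons]
      congr 1
      exact Finset.sum_congr rfl fun z _ => ih (by omega) (fun l => F (z :: l))

/-- The offset `c` makes the induction work: the deviation of the first sample is absorbed into it,
and the cross term vanishes because deviations from the mean sum to zero. -/
theorem iidAvg_sq_add_sum_sub [Nonempty Ω] (f : Ω → ℝ) (k : ℕ) (c : ℝ) :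
    iidAvg k (fun l => (c + (l.map f).sum - k * ((∑ z, f z) / Fintype.card Ω)) ^ 2) =
      c ^ 2 + k * ((∑ z, (f z - (∑ z, f z) / Fintype.card Ω) ^ 2) / Fintype.card Ω) := by
  set μ := (∑ z, f z) / Fintype.card Ω with hμ
  have hc : (Fintype.card Ω : ℝ) ≠ 0 := by simp
  induction k generalizing c with
  | zero => simp [iidAvg]
  | succ k ih =>
    have h1 : ∀ z, iidAvg k (fun l => (c + ((z :: l).map f).sum - ((k + 1 : ℕ) : ℝ) * μ) ^ 2) =
        (c + f z - μ) ^ 2 + k * ((∑ z, (f z - μ) ^ 2) / Fintype.card Ω) := by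
      intro z
      rw [← ih (c + f z - μ)]
      congr 1
      ext l
      simp only [List.map_cons, List.sum_cons]
      push_cast
      ring
    simp only [iidAvg, h1]
    have h2 : ∑ z, (c + f z - μ) ^ 2 = Fintype.card Ω * c ^ 2 + ∑ z, (f z - μ) ^ 2 := by
      have h3 : ∑ z, (f z - μ) = 0 := by
        rw [Finset.sum_sub_distrib, Finset.sum_const, Finset.card_univ, nsmul_eq_mul, hμ]
        field_simp
        simp
      have h4 : ∀ z, (c + f z - μ) ^ 2 = c ^ 2 + 2 * c * (f z - μ) + (f z - μ) ^ 2 := by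
        intro z; ring
      simp only [h4, Finset.sum_add_distrib, ← Finset.mul_sum, h3]
      simp
    rw [Finset.sum_add_distrib, h2, Finset.sum_const, Finset.card_univ, nsmul_eq_mul]
    field_simp
    push_cast
    ring

/-- Values in `[0, 1]` satisfy `f ^ 2 ≤ f`. A variance of order `μ` is what makes about `U / μ`
samples enough for a relative error. -/
theorem variance_le_mean_of_mem_Icc [Nonempty Ω] {f : Ω → ℝ} (h0 : ∀ z, 0 ≤ f z)
    (h1 : ∀ z, f z ≤ 1) :
    (∑ z, (f z - (∑ z, f z) / Fintype.card Ω) ^ 2) / Fintype.card Ω ≤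
      (∑ z, f z) / Fintype.card Ω := by
  set μ := (∑ z, f z) / Fintype.card Ω with hμ
  have hc : (0 : ℝ) < Fintype.card Ω := by exact_mod_cast Fintype.card_pos
  have h2 : ∑ z, f z = Fintype.card Ω * μ := by rw [hμ]; field_simp
  have h3 : ∑ z, (f z - μ) ^ 2 ≤ ∑ z, ((1 - 2 * μ) * f z + μ ^ 2) := by
    refine Finset.sum_le_sum fun z _ => ?_
    nlinarith [mul_nonneg (h0 z) (sub_nonneg.2 (h1 z))]
  rw [Finset.sum_add_distrib, ← Finset.mul_sum, h2, Finset.sum_const, Finset.card_univ,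
    nsmul_eq_mul] at h3
  rw [div_le_iff₀ hc]
  nlinarith [mul_nonneg hc.le (sq_nonneg μ)]

open Classical in
/-- Chebyshev's inequality for the sum of the first `t` of `k` independent samples. -/
theorem iidAvg_chebyshev [Nonempty Ω] {f : Ω → ℝ} (h0 : ∀ z, 0 ≤ f z) (h1 : ∀ z, f z ≤ 1)
    {μ : ℝ} (hμ : (∑ z, f z) / Fintype.card Ω = μ) {t k : ℕ} (htk : t ≤ k) {a : ℝ} (ha : 0 < a) :
    iidAvg k (fun l => if a ≤ |((l.take t).map f).sum - t * μ| then (1 : ℝ) else 0) ≤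
      t * μ / a ^ 2 := by
  rw [iidAvg_take htk (fun l => if a ≤ |(l.map f).sum - t * μ| then (1 : ℝ) else 0)]
  have h2 := iidAvg_sq_add_sum_sub f t 0
  have h3 := variance_le_mean_of_mem_Icc h0 h1
  rw [hμ] at h2 h3
  calc _ ≤ iidAvg t (fun l => (a ^ 2)⁻¹ * (0 + (l.map f).sum - t * μ) ^ 2) := by
        refine iidAvg_mono fun l _ => ?_
        split_ifs with h
        · rw [zero_add, ← sq_abs (_ - _), inv_mul_eq_div, le_div_iff₀ (by positivity), one_mul]
          gcongr
        · positivity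
    _ ≤ _ := by
        rw [iidAvg_const_mul, h2, inv_mul_eq_div]
        gcongr
        simp only [ne_eq, OfNat.ofNat_ne_zero, not_false_eq_true, zero_pow, zero_add]
        gcongr

end IidAverage

/-! ### Crossing times of partial sums -/

section Crossing

variable {α : Type*}

/-- The first time at which the partial sums of `f` along `l` reach `U`. -/
noncomputable def crossing (f : α → ℝ) (U : ℝ) (l : List α) : ℕ :=
  sInf {i | U ≤ ((l.take i).map f).sum}

theorem sum_map_take_mono {f : α → ℝ} (h0 : ∀ z, 0 ≤ f z) (l : List α) {s t : ℕ} (h : s ≤ t) :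
    ((l.take s).map f).sum ≤ ((l.take t).map f).sum := by
  have h1 : l.take t = l.take s ++ (l.drop s).take (t - s) := by
    rw [← List.take_add]; congr 1; omega
  rw [h1, List.map_append, List.sum_append, le_add_iff_nonneg_right]
  exact List.sum_nonneg fun x hx => by
    obtain ⟨z, -, rfl⟩ := List.mem_map.1 hx
    exact h0 z

/-- Partial sums increase, so control at two deterministic times traps the crossing time seen at any
stopping time `s`. If the list ends before `t₂`, then already `s ≤ t₂`. -/
theorem crossing_take_bounds {f : α → ℝ} (h0 : ∀ z, 0 ≤ f z) {U : ℝ} {l : List α} {s t₁ t₂ : ℕ}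
    (hs : U ≤ ((l.take s).map f).sum) (hl : s ≤ l.length)
    (h1 : ((l.take t₁).map f).sum < U) (h2 : t₂ ≤ l.length → U ≤ ((l.take t₂).map f).sum) :
    t₁ < crossing f U (l.take s) ∧ crossing f U (l.take s) ≤ t₂ := by
  have hmem : s ∈ {i | U ≤ (((l.take s).take i).map f).sum} := by
    rw [Set.mem_ofPred_eq, List.take_take, min_self]
    exact hs
  constructor
  · by_contra! hc
    have h3 := Nat.sInf_mem ⟨s, hmem⟩
    change U ≤ (((l.take s).take (crossing f U (l.take s))).map f).sum at h3
    rw [List.take_take] at h3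
    exact absurd (h3.trans (sum_map_take_mono h0 l ((min_le_left _ _).trans hc))) (not_le.2 h1)
  · rcases le_total t₂ s with h | h
    · refine Nat.sInf_le ?_
      simp only [Set.mem_ofPred_eq, List.take_take, min_eq_left h]
      exact h2 (h.trans hl)
    · exact (Nat.sInf_le hmem).trans h

/-- The partial sums of `f` along `l` are within `U * η` of their expectation at the last time at
which they are expected to be at most `U * (1 - η)`, and at the first time at which they are
expected to be at least `U * (1 + η)`. -/
def Concentrated (f : α → ℝ) (μ U η : ℝ) (l : List α) : Prop :=
  |((l.take (min ⌊U * (1 - η) / μ⌋₊ l.length)).map f).sum -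
      (min ⌊U * (1 - η) / μ⌋₊ l.length : ℕ) * μ| < U * η ∧
    (⌈U * (1 + η) / μ⌉₊ ≤ l.length →
      |((l.take ⌈U * (1 + η) / μ⌉₊).map f).sum - ⌈U * (1 + η) / μ⌉₊ * μ| < U * η)

theorem Concentrated.le_sum {f : α → ℝ} {μ U η : ℝ} {l : List α} (h : Concentrated f μ U η l)
    (hμ : 0 < μ) (ht : ⌈U * (1 + η) / μ⌉₊ ≤ l.length) :
    U ≤ ((l.take ⌈U * (1 + η) / μ⌉₊).map f).sum := by
  have h1 := (abs_lt.1 (h.2 ht)).1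
  have h2 := Nat.le_ceil (U * (1 + η) / μ)
  rw [div_le_iff₀ hμ] at h2
  linarith

theorem Concentrated.sum_lt {f : α → ℝ} {μ U η : ℝ} {l : List α} (h : Concentrated f μ U η l)
    (hμ : 0 < μ) (hU : 0 < U) (hη : η < 1) :
    ((l.take ⌊U * (1 - η) / μ⌋₊).map f).sum < U := by
  have h1 := (abs_lt.1 h.1).2
  have h2 := Nat.floor_le (a := U * (1 - η) / μ)
    (div_nonneg (mul_nonneg hU.le (sub_nonneg.2 hη.le)) hμ.le)
  have h3 : ((min ⌊U * (1 - η) / μ⌋₊ l.length : ℕ) : ℝ) ≤ U * (1 - η) / μ :=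
    le_trans (by exact_mod_cast min_le_left _ _) h2
  rw [le_div_iff₀ hμ] at h3
  have h4 : l.take (min ⌊U * (1 - η) / μ⌋₊ l.length) = l.take ⌊U * (1 - η) / μ⌋₊ := by
    rcases le_total ⌊U * (1 - η) / μ⌋₊ l.length with h | h
    · rw [min_eq_left h]
    · rw [min_eq_right h, List.take_length, List.take_of_length_le h]
  rw [h4] at h1
  linarith

/-- The asymmetry between `η` and `2 * η` pays for the ceiling: rounding up costs at most `μ ≤ 1 ≤ U
* η`. -/
theorem Concentrated.crossing_mul_mem {f : α → ℝ} (h0 : ∀ z, 0 ≤ f z) {μ U η : ℝ} {l : List α}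
    (h : Concentrated f μ U η l) (hμ : 0 < μ) (hμ1 : μ ≤ 1) (hη : η < 1) (hUη : 1 ≤ U * η)
    (hU : 0 < U) {s : ℕ} (hs : U ≤ ((l.take s).map f).sum) (hl : s ≤ l.length) :
    U * (1 - η) ≤ crossing f U (l.take s) * μ ∧
      crossing f U (l.take s) * μ ≤ U * (1 + 2 * η) := by
  obtain ⟨h1, h2⟩ := crossing_take_bounds h0 hs hl (h.sum_lt hμ hU hη) (h.le_sum hμ)
  constructor
  · rw [← div_le_iff₀ hμ]
    exact ((Nat.lt_floor_add_one _).trans_le (by exact_mod_cast h1)).le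
  · have h3 : (0 : ℝ) ≤ U * (1 + η) / μ := div_nonneg (by nlinarith) hμ.le
    have h4 := Nat.ceil_lt_add_one h3
    have h5 : (crossing f U (l.take s) : ℝ) < U * (1 + η) / μ + 1 :=
      lt_of_le_of_lt (by exact_mod_cast h2) h4
    have h6 := mul_lt_mul_of_pos_right h5 hμ
    rw [add_mul, div_mul_cancel₀ _ hμ.ne'] at h6
    nlinarith

open Classical in
-- Chebyshev at the two deterministic times, where the expected sums are at most `U` and `3 * U`.
-- The second is needed only when it occurs within `T` samples.
theorem iidAvg_not_concentrated_le {Ω : Type*} [Fintype Ω] [Nonempty Ω] {f : Ω → ℝ}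
    (h0 : ∀ z, 0 ≤ f z) (h1 : ∀ z, f z ≤ 1) {μ U η : ℝ}
    (hμ : (∑ z, f z) / Fintype.card Ω = μ) (hμ0 : 0 < μ) (hη0 : 0 < η) (hη : η < 1)
    (hUη : 1 ≤ U * η) (T : ℕ) :
    iidAvg T (fun l => if Concentrated f μ U η l then (0 : ℝ) else 1) ≤ 4 / (U * η ^ 2) := by
  have hU : 0 < U := pos_of_mul_pos_left (by linarith) hη0.le
  have hμ1 : μ ≤ 1 := by
    rw [← hμ, div_le_one (by exact_mod_cast Fintype.card_pos)]
    simpa using Finset.sum_le_sum (s := Finset.univ) fun z _ => h1 z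
  set t₁ := min ⌊U * (1 - η) / μ⌋₊ T with ht1
  set t₂ := ⌈U * (1 + η) / μ⌉₊ with ht2
  have b1 : (t₁ : ℝ) * μ ≤ U := by
    have h2 := Nat.floor_le (a := U * (1 - η) / μ)
      (div_nonneg (mul_nonneg hU.le (sub_nonneg.2 hη.le)) hμ0.le)
    have h3 : (t₁ : ℝ) ≤ U * (1 - η) / μ := le_trans (by exact_mod_cast min_le_left _ _) h2
    rw [le_div_iff₀ hμ0] at h3
    nlinarith
  have b2 : (t₂ : ℝ) * μ ≤ 3 * U := by
    have h4 := Nat.ceil_lt_add_one (a := U * (1 + η) / μ) (div_nonneg (by nlinarith) hμ0.le)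
    have h6 := mul_lt_mul_of_pos_right h4 hμ0
    rw [add_mul, div_mul_cancel₀ _ hμ0.ne'] at h6
    nlinarith
  have key : iidAvg T (fun l => if Concentrated f μ U η l then (0 : ℝ) else 1) ≤
      t₁ * μ / (U * η) ^ 2 + (if t₂ ≤ T then (t₂ * μ / (U * η) ^ 2) else 0) := by
    have c1 := iidAvg_chebyshev h0 h1 hμ (min_le_right ⌊U * (1 - η) / μ⌋₊ T)
      (a := U * η) (by positivity)
    rw [← ht1] at c1
    split_ifs with h
    · have c2 := iidAvg_chebyshev h0 h1 hμ h (a := U * η) (by positivity)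
      refine le_trans ?_ (add_le_add c1 c2)
      rw [← iidAvg_add]
      refine iidAvg_mono fun l hl => ?_
      subst hl
      simp only [Concentrated, ← ht1, ← ht2, h, forall_const, ← not_le]
      split_ifs <;> first | (norm_num; done) | tauto
    · refine le_trans ?_ (add_le_add c1 le_rfl)
      rw [add_zero]
      refine iidAvg_mono fun l hl => ?_
      subst hl
      simp only [Concentrated, ← ht1, ← ht2, h, ← not_le]
      split_ifs <;> first | (norm_num; done) | tauto
  refine key.trans ?_
  have e1 : t₁ * μ / (U * η) ^ 2 ≤ U / (U * η) ^ 2 := by gcongr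
  have e2 : (if t₂ ≤ T then (t₂ * μ / (U * η) ^ 2) else 0) ≤ 3 * U / (U * η) ^ 2 := by
    split_ifs
    · gcongr
    · positivity
  calc _ ≤ U / (U * η) ^ 2 + 3 * U / (U * η) ^ 2 := add_le_add e1 e2
    _ = 4 / (U * η ^ 2) := by field_simp; norm_num

end Crossing

/-! ### Processes that observe in rounds and stop adaptively -/

section Rounds

variable {Ω O : Type*} [Fintype Ω]

open Classical in
/-- The probability that a process that observes `obs z` for a uniform `z` in each round, and stops
as soon as `dec` applied to the history is not `none`, stops within `k` rounds with an output
in `S`. -/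
noncomputable def roundProb (obs : Ω → O) (dec : List O → Option ℝ) (S : Set ℝ) :
    ℕ → List O → ℝ
  | 0, h => (dec h).elim 0 (fun x => if x ∈ S then 1 else 0)
  | k + 1, h => (dec h).elim ((∑ z, roundProb obs dec S k (h ++ [obs z])) / Fintype.card Ω)
      (fun x => if x ∈ S then 1 else 0)

/-- Some prefix of the history leads to an output, and every output so obtained lies in `S`. -/
def GoodHistory (dec : List O → Option ℝ) (S : Set ℝ) (l : List O) : Prop :=
  (∃ i ≤ l.length, dec (l.take i) ≠ none) ∧ ∀ i ≤ l.length, ∀ x, dec (l.take i) = some x → x ∈ S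

theorem roundProb_nonneg (obs : Ω → O) (dec : List O → Option ℝ) (S : Set ℝ) (k : ℕ)
    (h : List O) : 0 ≤ roundProb obs dec S k h := by
  induction k generalizing h with
  | zero => rw [roundProb]; cases dec h <;> simp; split_ifs <;> norm_num
  | succ k ih =>
    rw [roundProb]
    cases dec h with
    | some x => simp; split_ifs <;> norm_num
    | none => exact div_nonneg (Finset.sum_nonneg fun z _ => ih _) (by positivity)

open Classical in
-- `GoodHistory` quantifies over all prefixes, hence over all possible stopping times. This replaces
-- the adaptively stopped process by a fixed number of independent samples.
theorem iidAvg_goodHistory_le_roundProb [Nonempty Ω] (obs : Ω → O) (dec : List O → Option ℝ)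
    (S : Set ℝ) (k : ℕ) (h : List O) (hh : ∀ i < h.length, dec (h.take i) = none) :
    iidAvg k (fun l => if GoodHistory dec S (h ++ l.map obs) then (1 : ℝ) else 0) ≤
      roundProb obs dec S k h := by
  have stopped : ∀ h x, dec h = some x → ∀ k,
      iidAvg k (fun l => if GoodHistory dec S (h ++ l.map obs) then (1 : ℝ) else 0) ≤
        if x ∈ S then 1 else 0 := by
    intro h x hx k
    rw [← iidAvg_const (Ω := Ω) k (if x ∈ S then 1 else 0)]
    refine iidAvg_mono fun l _ => ?_
    by_cases hg : GoodHistory dec S (h ++ l.map obs)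
    · have := hg.2 h.length (by simp) x (by simpa using hx)
      simp [hg, this]
    · simp only [hg, if_false]
      split_ifs <;> norm_num
  induction k generalizing h with
  | zero =>
    cases hd : dec h with
    | some x => simpa [roundProb, hd] using stopped h x hd 0
    | none =>
      have : ¬ GoodHistory dec S h := by
        rintro ⟨⟨i, hi, hne⟩, -⟩
        rcases hi.lt_or_eq with hi | rfl
        · exact hne (hh i hi)
        · exact hne (by simpa using hd)
      simp [iidAvg, roundProb, hd, this]
  | succ k ih =>
    cases hd : dec h with
    | some x => simpa [roundProb, hd] using stopped h x hd (k + 1)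
    | none =>
      simp only [iidAvg, roundProb, hd, Option.elim_none, List.map_cons]
      gcongr with z
      have h1 : ∀ i < (h ++ [obs z]).length, dec ((h ++ [obs z]).take i) = none := by
        intro i hi
        rw [List.length_append, List.length_singleton, Nat.lt_succ_iff] at hi
        rw [List.take_append_of_le_length hi]
        rcases hi.lt_or_eq with hi | rfl
        · exact hh i hi
        · simpa using hd
      simpa only [List.append_assoc, List.singleton_append] using ih (h ++ [obs z]) h1

end Rounds

/-! ### The estimator and its stopping rule -/

noncomputable section

section Estimator

/-- The degrees of a random vertex and of the two endpoints of a random edge. -/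
abbrev DegreeSample : Type := ℕ × ℕ × ℕ

/-- The degree of a random vertex, truncated at `2 ^ j` and scaled to `[0, 1]`. -/
def vertexStat (j : ℕ) (o : DegreeSample) : ℝ := min ((o.1 : ℝ) / 2 ^ j) 1

/-- The weight `min 1 (2 ^ j / deg)` averaged over the endpoints of a random edge. -/
def edgeStat (j : ℕ) (o : DegreeSample) : ℝ :=
  (min 1 ((2 : ℝ) ^ j / o.2.1) + min 1 ((2 : ℝ) ^ j / o.2.2)) / 2

theorem vertexStat_nonneg (j : ℕ) (o : DegreeSample) : 0 ≤ vertexStat j o :=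
  le_min (by positivity) zero_le_one

theorem vertexStat_le_one (j : ℕ) (o : DegreeSample) : vertexStat j o ≤ 1 := min_le_right _ _

theorem edgeStat_nonneg (j : ℕ) (o : DegreeSample) : 0 ≤ edgeStat j o := by
  have h : ∀ b : ℕ, 0 ≤ min 1 ((2 : ℝ) ^ j / b) := fun b => le_min zero_le_one (by positivity)
  have := h o.2.1
  have := h o.2.2
  rw [edgeStat]
  positivity

theorem edgeStat_le_one (j : ℕ) (o : DegreeSample) : edgeStat j o ≤ 1 := by
  have h : ∀ b : ℕ, min 1 ((2 : ℝ) ^ j / b) ≤ 1 := fun b => min_le_left _ _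
  rw [edgeStat]
  linarith [h o.2.1, h o.2.2]

/-- The value that the sums of the statistics at scale `2 ^ j` have to reach. -/
def threshold (ε : ℝ) (j : ℕ) : ℝ := 102400 * ((j + 1) * (j + 2)) / ε ^ 2

/-- Both sums of statistics at scale `2 ^ j` have reached the threshold. -/
def ScaleDone (ε : ℝ) (h : List DegreeSample) (j : ℕ) : Prop :=
  threshold ε j ≤ (h.map (vertexStat j)).sum ∧ threshold ε j ≤ (h.map (edgeStat j)).sum

open Classical in
/-- The stopping rule: as soon as some scale is done, output the scaled ratio of the times at which
the two sums of statistics have crossed the threshold. -/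
def stoppingRule (ε : ℝ) (h : List DegreeSample) : Option ℝ :=
  if hj : ∃ j, ScaleDone ε h j then
    some (2 ^ Nat.find hj * crossing (edgeStat (Nat.find hj)) (threshold ε (Nat.find hj)) h /
      crossing (vertexStat (Nat.find hj)) (threshold ε (Nat.find hj)) h)
  else none

variable {ε : ℝ}

theorem succ_le_threshold (h0 : 0 < ε) (h1 : ε < 1) (j : ℕ) :
    ((j : ℝ) + 1) * 102400 ≤ threshold ε j := by
  rw [threshold, le_div_iff₀ (by positivity)]
  have h2 : ε ^ 2 ≤ 1 := pow_le_one₀ h0.le h1.le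
  have h3 : (0 : ℝ) ≤ j := j.cast_nonneg
  nlinarith [mul_nonneg (show (0 : ℝ) ≤ (j + 1) * 102400 by positivity) (sub_nonneg.2 h2)]

theorem threshold_pos (h0 : 0 < ε) (j : ℕ) : 0 < threshold ε j := by
  rw [threshold]; positivity

theorem one_le_threshold_mul (h0 : 0 < ε) (h1 : ε < 1) (j : ℕ) :
    1 ≤ threshold ε j * (ε / 8) := by
  rw [threshold, div_mul_eq_mul_div, le_div_iff₀ (by positivity)]
  have h3 : (0 : ℝ) ≤ j := j.cast_nonneg
  have h4 : (1 : ℝ) ≤ (j + 1) * (j + 2) := by nlinarith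
  nlinarith [mul_pos h0 h0, mul_le_mul_of_nonneg_right h4 h0.le]

/-- Each round adds at most `1` while the threshold exceeds `j + 1`. So only finitely many scales
can trigger a stop, and the union bound is finite. -/
theorem ScaleDone.lt_length (h0 : 0 < ε) (h1 : ε < 1) {h : List DegreeSample} {j : ℕ}
    (hj : ScaleDone ε h j) : j < h.length := by
  have h2 : (h.map (vertexStat j)).sum ≤ h.length := by
    have := List.sum_le_card_nsmul (h.map (vertexStat j)) 1 (by
      intro x hx
      obtain ⟨o, -, rfl⟩ := List.mem_map.1 hx
      exact vertexStat_le_one j o)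
    simpa using this
  have h3 := (succ_le_threshold h0 h1 j).trans (hj.1.trans h2)
  have h4 : (0 : ℝ) ≤ j := j.cast_nonneg
  exact_mod_cast (show (j : ℝ) < h.length by linarith)

/-- Since `τ = d β / α`, the estimate is `d` times the ratio of `b β` to `a α`. These differ by at
most `U * (3 ε / 8)`, and `a α ≥ 7 U / 8`. -/
theorem abs_ratio_sub_le {a b α β U τ d : ℝ} (h0 : 0 < ε) (h1 : ε < 1) (hα : 0 < α)
    (hU : 0 < U) (hd : 0 < d) (hdβ : d * β = τ * α)
    (ha : U * (1 - ε / 8) ≤ a * α) (ha' : a * α ≤ U * (1 + 2 * (ε / 8)))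
    (hb : U * (1 - ε / 8) ≤ b * β) (hb' : b * β ≤ U * (1 + 2 * (ε / 8))) :
    |τ * b / a - d| ≤ ε * d := by
  have h2 : 0 < a * α := lt_of_lt_of_le (mul_pos hU (by linarith)) ha
  have h3 : 0 < a := pos_of_mul_pos_left h2 hα.le
  have h4 : τ = d * β / α := by field_simp; linarith
  have h5 : τ * b / a - d = d * ((b * β - a * α) / (a * α)) := by
    rw [h4]; field_simp
  rw [h5, abs_mul, abs_of_pos hd, mul_comm ε]
  gcongr
  rw [abs_div, abs_of_pos h2, div_le_iff₀ h2, abs_le]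
  have h6 := mul_le_mul_of_nonneg_left ha h0.le
  have h7 := mul_pos hU h0
  have h8 := mul_pos h7 (sub_pos.2 h1)
  constructor <;> nlinarith

/-- Concentration at all scales makes the output correct whichever scale stops first and whenever it
does. The scale `j₀` serves only to guarantee that some scale stops. -/
theorem goodHistory_of_concentrated (h0 : 0 < ε) (h1 : ε < 1) {l : List DegreeSample}
    {α β : ℕ → ℝ} {d : ℝ} (hd : 0 < d) (hα0 : ∀ j, 0 < α j) (hα1 : ∀ j, α j ≤ 1)
    (hβ0 : ∀ j, 0 < β j) (hβ1 : ∀ j, β j ≤ 1) (hαβ : ∀ j, d * β j = 2 ^ j * α j)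
    (hcα : ∀ j < l.length, Concentrated (vertexStat j) (α j) (threshold ε j) (ε / 8) l)
    (hcβ : ∀ j < l.length, Concentrated (edgeStat j) (β j) (threshold ε j) (ε / 8) l)
    {j₀ : ℕ} (hj₀ : j₀ < l.length) (htα : ⌈threshold ε j₀ * (1 + ε / 8) / α j₀⌉₊ ≤ l.length)
    (htβ : ⌈threshold ε j₀ * (1 + ε / 8) / β j₀⌉₊ ≤ l.length) :
    GoodHistory (stoppingRule ε) {x | |x - d| ≤ ε * d} l := by
  classical
  constructor
  · refine ⟨l.length, le_rfl, ?_⟩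
    rw [List.take_length, stoppingRule, dif_pos]
    · simp
    · have := sum_map_take_mono (vertexStat_nonneg j₀) l htα
      have := sum_map_take_mono (edgeStat_nonneg j₀) l htβ
      rw [List.take_length] at *
      exact ⟨j₀, ((hcα j₀ hj₀).le_sum (hα0 _) htα).trans (by assumption),
        ((hcβ j₀ hj₀).le_sum (hβ0 _) htβ).trans (by assumption)⟩
  · intro i hi x hx
    rw [stoppingRule] at hx
    split_ifs at hx with hex
    have hj := Nat.find_spec hex
    generalize Nat.find hex = j at hx hj
    have hjl : j < l.length := (hj.lt_length h0 h1).trans_le (List.length_take_le' i l)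
    have hU := threshold_pos h0 j
    have hUη := one_le_threshold_mul h0 h1 j
    obtain ⟨a1, a2⟩ := (hcα j hjl).crossing_mul_mem (vertexStat_nonneg j) (hα0 j) (hα1 j)
      (by linarith) hUη hU hj.1 hi
    obtain ⟨b1, b2⟩ := (hcβ j hjl).crossing_mul_mem (edgeStat_nonneg j) (hβ0 j) (hβ1 j)
      (by linarith) hUη hU hj.2 hi
    rw [← Option.some.inj hx]
    exact abs_ratio_sub_le h0 h1 (hα0 j) hU hd (hαβ j) a1 a2 b1 b2

theorem concentrated_map {Ω : Type*} {obs : Ω → DegreeSample} {f : DegreeSample → ℝ}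
    {μ U η : ℝ} {l : List Ω} :
    Concentrated f μ U η (l.map obs) ↔ Concentrated (f ∘ obs) μ U η l := by
  simp [Concentrated, ← List.map_take]

theorem sum_one_div_succ_mul_le (T : ℕ) :
    ∑ j ∈ Finset.range T, 1 / (((j : ℝ) + 1) * (j + 2)) ≤ 1 := by
  have h : ∀ T : ℕ, ∑ j ∈ Finset.range T, 1 / (((j : ℝ) + 1) * (j + 2)) = 1 - 1 / (T + 1) := by
    intro T
    induction T with
    | zero => simp
    | succ T ih =>
      rw [Finset.sum_range_succ, ih]
      push_cast
      field_simp
      ring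
  rw [h]
  have : (0 : ℝ) ≤ 1 / (T + 1) := by positivity
  linarith

/-- A union bound over scales and both statistics. With `η = ε / 8`, each statistic at scale `j`
fails with probability at most `4 / (1600 (j + 1)(j + 2))`, which is where the constant `102400 = 64
* 1600` comes from; the telescoping series gives at most `1 / 200` in total. -/
theorem lt_roundProb_stoppingRule {Ω : Type*} [Fintype Ω] [Nonempty Ω] (obs : Ω → DegreeSample)
    (h0 : 0 < ε) (h1 : ε < 1) {α β : ℕ → ℝ} {d : ℝ} (hd : 0 < d)
    (hα : ∀ j, (∑ z, vertexStat j (obs z)) / Fintype.card Ω = α j)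
    (hβ : ∀ j, (∑ z, edgeStat j (obs z)) / Fintype.card Ω = β j)
    (hα0 : ∀ j, 0 < α j) (hα1 : ∀ j, α j ≤ 1)
    (hβ0 : ∀ j, 0 < β j) (hβ1 : ∀ j, β j ≤ 1) (hαβ : ∀ j, d * β j = 2 ^ j * α j)
    {T j₀ : ℕ} (htα : ⌈threshold ε j₀ * (1 + ε / 8) / α j₀⌉₊ ≤ T)
    (htβ : ⌈threshold ε j₀ * (1 + ε / 8) / β j₀⌉₊ ≤ T) :
    99 / 100 < roundProb obs (stoppingRule ε) {x | |x - d| ≤ ε * d} T [] := by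
  classical
  have hj₀ : j₀ < T := by
    have h2 := (Nat.le_ceil _).trans (Nat.cast_le (α := ℝ).2 htα)
    rw [div_le_iff₀ (hα0 j₀)] at h2
    have h3 := succ_le_threshold h0 h1 j₀
    have h4 : (T : ℝ) * α j₀ ≤ T := mul_le_of_le_one_right T.cast_nonneg (hα1 j₀)
    have h5 : threshold ε j₀ ≤ threshold ε j₀ * (1 + ε / 8) :=
      le_mul_of_one_le_right (threshold_pos h0 j₀).le (by linarith)
    have h6 : (0 : ℝ) ≤ j₀ := j₀.cast_nonneg
    exact_mod_cast (show (j₀ : ℝ) < T by linarith)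
  refine lt_of_lt_of_le ?_
    (iidAvg_goodHistory_le_roundProb obs (stoppingRule ε) _ T [] (by simp))
  have key : iidAvg T (fun _ : List Ω => (1 : ℝ)) ≤
      iidAvg T (fun l => (if GoodHistory (stoppingRule ε) {x | |x - d| ≤ ε * d}
        ([] ++ l.map obs) then (1 : ℝ) else 0) + ∑ j ∈ Finset.range T,
        ((if Concentrated (vertexStat j ∘ obs) (α j) (threshold ε j) (ε / 8) l then (0 : ℝ) else 1)
        + (if Concentrated (edgeStat j ∘ obs) (β j) (threshold ε j) (ε / 8) l then (0 : ℝ)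
          else 1))) := by
    refine iidAvg_mono fun l hl => ?_
    have hnn : ∀ j ∈ Finset.range T, (0 : ℝ) ≤
        ((if Concentrated (vertexStat j ∘ obs) (α j) (threshold ε j) (ε / 8) l then (0 : ℝ) else 1)
        + (if Concentrated (edgeStat j ∘ obs) (β j) (threshold ε j) (ε / 8) l then (0 : ℝ)
          else 1)) := by
      intro j _
      split_ifs <;> norm_num
    by_cases hc : ∀ j < T, Concentrated (vertexStat j ∘ obs) (α j) (threshold ε j) (ε / 8) l ∧
        Concentrated (edgeStat j ∘ obs) (β j) (threshold ε j) (ε / 8) l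
    · rw [if_pos]
      · exact le_add_of_nonneg_right (Finset.sum_nonneg hnn)
      · have hlen : (l.map obs).length = T := by simpa using hl
        rw [List.nil_append]
        refine goodHistory_of_concentrated h0 h1 hd hα0 hα1 hβ0 hβ1 hαβ
          (fun j hj => concentrated_map.2 (hc j (hlen ▸ hj)).1)
          (fun j hj => concentrated_map.2 (hc j (hlen ▸ hj)).2) (j₀ := j₀) ?_ ?_ ?_ <;>
        rwa [hlen]
    · push Not at hc
      obtain ⟨j, hj, hc⟩ := hc
      refine le_add_of_nonneg_of_le (by split_ifs <;> norm_num) ?_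
      refine le_trans ?_ (Finset.single_le_sum hnn (Finset.mem_range.2 hj))
      split_ifs <;> first | (norm_num; done) | tauto
  rw [iidAvg_const, iidAvg_add, iidAvg_sum] at key
  have bound : ∑ j ∈ Finset.range T, iidAvg T (fun l =>
        ((if Concentrated (vertexStat j ∘ obs) (α j) (threshold ε j) (ε / 8) l then (0 : ℝ) else 1)
        + (if Concentrated (edgeStat j ∘ obs) (β j) (threshold ε j) (ε / 8) l then (0 : ℝ)
          else 1))) ≤ ∑ j ∈ Finset.range T, 1 / 200 * (1 / (((j : ℝ) + 1) * (j + 2))) := by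
    refine Finset.sum_le_sum fun j _ => ?_
    rw [iidAvg_add]
    have c1 := iidAvg_not_concentrated_le (f := vertexStat j ∘ obs)
      (fun z => vertexStat_nonneg j _) (fun z => vertexStat_le_one j _) (hα j) (hα0 j)
      (show 0 < ε / 8 by positivity) (by linarith) (one_le_threshold_mul h0 h1 j) T
    have c2 := iidAvg_not_concentrated_le (f := edgeStat j ∘ obs)
      (fun z => edgeStat_nonneg j _) (fun z => edgeStat_le_one j _) (hβ j) (hβ0 j)
      (show 0 < ε / 8 by positivity) (by linarith) (one_le_threshold_mul h0 h1 j) T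
    refine (add_le_add c1 c2).trans (le_of_eq ?_)
    rw [threshold]
    field_simp
    norm_num
  rw [← Finset.mul_sum] at bound
  have := sum_one_div_succ_mul_le T
  linarith

end Estimator

end

/-! ### The degree-sampling algorithm in the query model -/

noncomputable section

/-- The states of an algorithm that in each round asks for the degrees of a random vertex and of the
endpoints of a random edge. Each state stores the history of the previous rounds. -/
inductive DegreeSamplerState : Type
  | start (h : List DegreeSample)
  | vertex (h : List DegreeSample) (x : ℕ)
  | edge (h : List DegreeSample) (a : ℕ)
  | left (h : List DegreeSample) (a x y : ℕ)
  | right (h : List DegreeSample) (a b y : ℕ)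

/-- The algorithm that samples degrees in rounds until `dec` of the history yields an output. -/
def degreeSampler (dec : List DegreeSample → Option ℝ) : QueryAlgorithm where
  State := DegreeSamplerState
  init := PMF.pure (.start [])
  next
    | .start h => (dec h).elim
        (.inl ⟨.randVert, fun x : ℕ => PMF.pure (.vertex h x)⟩) .inr
    | .vertex h x => .inl ⟨.degree x, fun r : Option ℕ => PMF.pure (.edge h (r.getD 0))⟩
    | .edge h a => .inl ⟨.randEdge, fun e : Sym2 ℕ =>
        PMF.pure (.left h a (Quot.out e).1 (Quot.out e).2)⟩
    | .left h a x y => .inl ⟨.degree x, fun r : Option ℕ => PMF.pure (.right h a (r.getD 0) y)⟩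
    | .right h a b y => .inl ⟨.degree y, fun r : Option ℕ =>
        PMF.pure (.start (h ++ [(a, b, r.getD 0)]))⟩

/-- The identifiers stored in a state for later queries are in `K`. -/
def DegreeSamplerState.Known (K : Finset ℕ) : DegreeSamplerState → Prop
  | .start _ => True
  | .vertex _ x => x ∈ K
  | .edge _ _ => True
  | .left _ _ x y => x ∈ K ∧ y ∈ K
  | .right _ _ _ y => y ∈ K

theorem degreeSampler_inBaseModel (dec : List DegreeSample → Option ℝ) :
    (degreeSampler dec).InBaseModelWithRandEdge := by
  have inv : ∀ (s : (degreeSampler dec).State) (K : Finset ℕ), (degreeSampler dec).Reaches s K →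
      DegreeSamplerState.Known K s := by
    intro s K hs
    induction hs with
    | init h =>
      have h' := (PMF.mem_support_pure_iff _ _).1 h
      subst h'
      trivial
    | @step s s' K q f r _ hn hs' ih =>
      cases s with
      | start h =>
        cases hd : dec h with
        | some x => simp [degreeSampler, hd] at hn
        | none =>
          simp only [degreeSampler, hd, Option.elim_none, Sum.inl.injEq] at hn
          cases hn
          have h' := (PMF.mem_support_pure_iff _ _).1 hs'
          subst h'
          exact Finset.mem_union_right _ (Finset.mem_singleton_self _)
      | vertex h x =>
        simp only [degreeSampler, Sum.inl.injEq] at hn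
        cases hn
        have h' := (PMF.mem_support_pure_iff _ _).1 hs'
        subst h'
        trivial
      | edge h a =>
        simp only [degreeSampler, Sum.inl.injEq] at hn
        cases hn
        have h' := (PMF.mem_support_pure_iff _ _).1 hs'
        subst h'
        -- The representative chosen by `Quot.out` maps back to the sampled edge, so both stored
        -- endpoints were revealed.
        have h2 : s((Quot.out (r : Sym2 ℕ)).1, (Quot.out (r : Sym2 ℕ)).2) = r := Quot.out_eq _
        constructor
        · refine Finset.mem_union_right _ (Sym2.mem_toFinset.2 ?_)
          have h3 := Sym2.mem_mk_left (Quot.out (r : Sym2 ℕ)).1 (Quot.out (r : Sym2 ℕ)).2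
          rwa [h2] at h3
        · refine Finset.mem_union_right _ (Sym2.mem_toFinset.2 ?_)
          have h3 := Sym2.mem_mk_right (Quot.out (r : Sym2 ℕ)).1 (Quot.out (r : Sym2 ℕ)).2
          rwa [h2] at h3
      | left h a x y =>
        simp only [degreeSampler, Sum.inl.injEq] at hn
        cases hn
        have h' := (PMF.mem_support_pure_iff _ _).1 hs'
        subst h'
        exact Finset.mem_union_left _ ih.2
      | right h a b y =>
        simp only [degreeSampler, Sum.inl.injEq] at hn
        cases hn
        have h' := (PMF.mem_support_pure_iff _ _).1 hs'
        subst h'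
        trivial
  intro s K q f hs hn
  have hi := inv s K hs
  cases s with
  | start h =>
    cases hd : dec h with
    | some x => simp [degreeSampler, hd] at hn
    | none =>
      simp only [degreeSampler, hd, Option.elim_none, Sum.inl.injEq] at hn
      cases hn
      exact ⟨trivial, Finset.empty_subset _⟩
  | vertex h x =>
    simp only [degreeSampler, Sum.inl.injEq] at hn
    cases hn
    exact ⟨trivial, Finset.singleton_subset_iff.2 hi⟩
  | edge h a =>
    simp only [degreeSampler, Sum.inl.injEq] at hn
    cases hn
    exact ⟨trivial, Finset.empty_subset _⟩
  | left h a x y =>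
    simp only [degreeSampler, Sum.inl.injEq] at hn
    cases hn
    exact ⟨trivial, Finset.singleton_subset_iff.2 hi.1⟩
  | right h a b y =>
    simp only [degreeSampler, Sum.inl.injEq] at hn
    cases hn
    exact ⟨trivial, Finset.singleton_subset_iff.2 hi⟩

namespace InputGraph

variable (G : InputGraph)

@[simp]
theorem vertex_id (v : Fin G.n) : G.vertex (G.id v) = some v :=
  Function.partialInv_left G.id.injective v

open Classical in
/-- The degree of the vertex with identifier `x`, and `0` if there is none. -/
def degreeOfId (x : ℕ) : ℕ := ((G.vertex x).map (fun v => G.graph.degree v)).getD 0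

open Classical in
/-- The randomness of one round: a vertex and an edge. -/
abbrev RoundSpace : Type := Fin G.n × G.graph.edgeFinset

instance : Nonempty G.RoundSpace :=
  ⟨(Classical.arbitrary _, ⟨_, G.edgeFinset_nonempty.choose_spec⟩)⟩

/-- The degrees seen in a round. -/
def roundSample (z : G.RoundSpace) : DegreeSample :=
  (G.degreeOfId (G.id z.1), G.degreeOfId (Quot.out (Sym2.map G.id z.2.1)).1,
    G.degreeOfId (Quot.out (Sym2.map G.id z.2.1)).2)

end InputGraph

theorem PMF.toOuterMeasure_uniformOfFinset_bind {α β : Type*} (s : Finset α) (hs : s.Nonempty)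
    (f : α → PMF β) (X : Set β) :
    ((PMF.uniformOfFinset s hs).bind f).toOuterMeasure X =
      (∑ a ∈ s, (f a).toOuterMeasure X) / s.card := by
  classical
  rw [PMF.toOuterMeasure_bind_apply, tsum_eq_sum (s := s)]
  · rw [ENNReal.div_eq_inv_mul, Finset.mul_sum]
    exact Finset.sum_congr rfl fun a ha => by rw [PMF.uniformOfFinset_apply_of_mem _ ha]
  · intro a ha
    rw [PMF.uniformOfFinset_apply_of_notMem _ ha, zero_mul]

theorem QueryAlgorithm.runFrom_succ_of_next_eq_inl {A : QueryAlgorithm} (G : InputGraph) (k : ℕ)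
    {s : A.State} {q : Query} {f : q.Response → PMF A.State} (h : A.next s = .inl ⟨q, f⟩) :
    A.runFrom G (k + 1) s =
      (G.answer q).bind fun r => (f r).bind fun s' => A.runFrom G k s' := by
  simp only [QueryAlgorithm.runFrom, h]

open Classical in
-- One round costs five queries: two sampling queries and three degree queries.
theorem degreeSampler_runFrom_start (G : InputGraph) {dec : List DegreeSample → Option ℝ} (k : ℕ)
    {h : List DegreeSample} (hd : dec h = none) :
    (degreeSampler dec).runFrom G (k + 5) (.start h) =
      (PMF.uniformOfFinset Finset.univ Finset.univ_nonempty).bind fun v : Fin G.n =>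
        (PMF.uniformOfFinset G.graph.edgeFinset G.edgeFinset_nonempty).bind fun e =>
          (degreeSampler dec).runFrom G k (.start (h ++
            [(G.degreeOfId (G.id v), G.degreeOfId (Quot.out (Sym2.map G.id e)).1,
              G.degreeOfId (Quot.out (Sym2.map G.id e)).2)])) := by
  classical
  let run : ℕ → DegreeSamplerState → PMF (Option ℝ) := (degreeSampler dec).runFrom G
  have s1 : ∀ k, run (k + 1) (.start h) =
      (PMF.uniformOfFintype (Fin G.n)).bind fun v => run k (.vertex h (G.id v)) := by
    intro k
    have hn : (degreeSampler dec).next (.start h) =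
        .inl ⟨.randVert, fun x : ℕ => PMF.pure (.vertex h x)⟩ := by simp [degreeSampler, hd]
    refine (QueryAlgorithm.runFrom_succ_of_next_eq_inl G k hn).trans ?_
    change ((PMF.uniformOfFintype (Fin G.n)).map G.id).bind (fun x : ℕ =>
      (PMF.pure (DegreeSamplerState.vertex h x)).bind (run k)) = _
    simp only [PMF.pure_bind, PMF.bind_map]
    rfl
  have s2 : ∀ k h x, run (k + 1) (.vertex h x) = run k (.edge h (G.degreeOfId x)) := by
    intro k h x
    refine (QueryAlgorithm.runFrom_succ_of_next_eq_inl G k rfl).trans ?_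
    change (PMF.pure ((G.vertex x).map (fun v => G.graph.degree v))).bind (fun r : Option ℕ =>
      (PMF.pure (DegreeSamplerState.edge h (r.getD 0))).bind (run k)) = _
    simp only [PMF.pure_bind]
    rfl
  have s3 : ∀ k h a, run (k + 1) (.edge h a) =
      (PMF.uniformOfFinset G.graph.edgeFinset G.edgeFinset_nonempty).bind fun e =>
        run k (.left h a (Quot.out (Sym2.map G.id e)).1 (Quot.out (Sym2.map G.id e)).2) := by
    intro k h a
    refine (QueryAlgorithm.runFrom_succ_of_next_eq_inl G k rfl).trans ?_
    change ((PMF.uniformOfFinset G.graph.edgeFinset G.edgeFinset_nonempty).map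
      (Sym2.map G.id)).bind (fun e : Sym2 ℕ =>
      (PMF.pure (DegreeSamplerState.left h a (Quot.out e).1 (Quot.out e).2)).bind (run k)) = _
    simp only [PMF.pure_bind, PMF.bind_map]
    rfl
  have s4 : ∀ k h a x y, run (k + 1) (.left h a x y) =
      run k (.right h a (G.degreeOfId x) y) := by
    intro k h a x y
    refine (QueryAlgorithm.runFrom_succ_of_next_eq_inl G k rfl).trans ?_
    change (PMF.pure ((G.vertex x).map (fun v => G.graph.degree v))).bind (fun r : Option ℕ =>
      (PMF.pure (DegreeSamplerState.right h a (r.getD 0) y)).bind (run k)) = _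
    simp only [PMF.pure_bind]
    rfl
  have s5 : ∀ k h a b y, run (k + 1) (.right h a b y) =
      run k (.start (h ++ [(a, b, G.degreeOfId y)])) := by
    intro k h a b y
    refine (QueryAlgorithm.runFrom_succ_of_next_eq_inl G k rfl).trans ?_
    change (PMF.pure ((G.vertex y).map (fun v => G.graph.degree v))).bind (fun r : Option ℕ =>
      (PMF.pure (DegreeSamplerState.start (h ++ [(a, b, r.getD 0)]))).bind (run k)) = _
    simp only [PMF.pure_bind]
    rfl
  change run (k + 4 + 1) (.start h) = _
  rw [s1]
  simp only [s2, s3, s4, s5]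
  rfl

/-- A uniform pair in `RoundSpace` is the same as an independent vertex and edge, which matches each
step of the process with five queries of the algorithm. -/
theorem ofReal_roundProb_le (G : InputGraph) (dec : List DegreeSample → Option ℝ) (S : Set ℝ)
    (k : ℕ) (h : List DegreeSample) :
    ENNReal.ofReal (roundProb G.roundSample dec S k h) ≤
      ((degreeSampler dec).runFrom G (5 * k) (.start h)).toOuterMeasure (some '' S) := by
  classical
  have stopped : ∀ k h x, dec h = some x → ENNReal.ofReal (if x ∈ S then 1 else 0) ≤
      ((degreeSampler dec).runFrom G k (.start h)).toOuterMeasure (some '' S) := by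
    intro k h x hx
    have : (degreeSampler dec).runFrom G k (.start h) = PMF.pure (some x) := by
      cases k <;> simp [QueryAlgorithm.runFrom, degreeSampler, hx]
    rw [this, PMF.toOuterMeasure_pure_apply]
    by_cases hS : x ∈ S <;> simp [hS]
  induction k generalizing h with
  | zero =>
    cases hd : dec h with
    | some x => simpa [roundProb, hd] using stopped 0 h x hd
    | none => simp [roundProb, hd]
  | succ k ih =>
    cases hd : dec h with
    | some x => simpa [roundProb, hd] using stopped (5 * (k + 1)) h x hd
    | none =>
      have hrun := degreeSampler_runFrom_start G (5 * k) hd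
      rw [mul_add, mul_one, hrun, PMF.toOuterMeasure_uniformOfFinset_bind]
      simp only [PMF.toOuterMeasure_uniformOfFinset_bind, roundProb, hd, Option.elim_none]
      rw [Fintype.sum_prod_type, Fintype.card_prod, Finset.card_univ, Fintype.card_coe,
        Nat.cast_mul, ENNReal.ofReal_div_of_pos (by
          have := G.n_pos
          have := G.edgeFinset_nonempty.card_pos
          simp only [Fintype.card_fin]
          positivity)]
      rw [ENNReal.ofReal_mul (by positivity), ENNReal.ofReal_natCast, ENNReal.ofReal_natCast]
      rw [ENNReal.ofReal_sum_of_nonneg fun v _ =>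
        Finset.sum_nonneg fun e _ => roundProb_nonneg _ _ _ _ _]
      have hv : ∀ v, ENNReal.ofReal (∑ e : G.graph.edgeFinset, roundProb G.roundSample dec S k
          (h ++ [G.roundSample (v, e)])) ≤ ∑ e ∈ G.graph.edgeFinset,
          ((degreeSampler dec).runFrom G (5 * k) (.start (h ++
            [(G.degreeOfId (G.id v), G.degreeOfId (Quot.out (Sym2.map G.id e)).1,
              G.degreeOfId (Quot.out (Sym2.map G.id e)).2)]))).toOuterMeasure (some '' S) := by
        intro v
        rw [ENNReal.ofReal_sum_of_nonneg fun e _ => roundProb_nonneg _ _ _ _ _]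
        exact (Finset.sum_le_sum fun e _ => ih _).trans_eq
          (Finset.sum_coe_sort G.graph.edgeFinset (fun e =>
            ((degreeSampler dec).runFrom G (5 * k) (.start (h ++
              [(G.degreeOfId (G.id v), G.degreeOfId (Quot.out (Sym2.map G.id e)).1,
                G.degreeOfId (Quot.out (Sym2.map G.id e)).2)]))).toOuterMeasure (some '' S)))
      simp only [div_eq_mul_inv]
      rw [← Finset.sum_mul, mul_assoc, ← ENNReal.mul_inv (Or.inr (by simp)) (Or.inl (by simp)),
        Fintype.card_fin, mul_comm (G.graph.edgeFinset.card : ℝ≥0∞)]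
      gcongr with v
      exact hv v

theorem ofReal_roundProb_le_probWithin (G : InputGraph) (dec : List DegreeSample → Option ℝ)
    (S : Set ℝ) (k : ℕ) :
    ENNReal.ofReal (roundProb G.roundSample dec S k []) ≤
      (degreeSampler dec).probWithin G (5 * k) S := by
  rw [QueryAlgorithm.probWithin]
  change _ ≤ ((PMF.pure (DegreeSamplerState.start [])).bind
    (show DegreeSamplerState → PMF (Option ℝ) from
      (degreeSampler dec).runFrom G (5 * k))).toOuterMeasure (some '' S)
  rw [PMF.pure_bind]
  exact ofReal_roundProb_le G dec S k []

end

/-! ### Truncated degree sums of a graph -/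

noncomputable section

namespace SimpleGraph

variable {V : Type*} [Fintype V] [DecidableEq V] (G : SimpleGraph V) [DecidableRel G.Adj]

theorem sum_edgeFinset_sum_toFinset (g : V → ℝ) :
    ∑ e ∈ G.edgeFinset, ∑ v ∈ e.toFinset, g v = ∑ v, G.degree v * g v := by
  rw [Finset.sum_comm' (s' := fun v => G.incidenceFinset v) (t' := Finset.univ)]
  · simp
  · intro e v
    simp only [mem_edgeFinset, Sym2.mem_toFinset, Finset.mem_univ, and_true, mem_incidenceFinset]
    rfl

/-- Let `S` be the vertices of degree above `τ`. From `|S| τ ≤ 2m ≤ τ ^ 2` it follows that `|S| ≤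
τ`, so adjacencies inside `S` number at most `|S| τ`. The other adjacencies of `S` are charged to
the light endpoints. Hence `2m ≤ |S| τ + 2 ∑_light deg`, at most twice the truncated sum. -/
theorem card_edgeFinset_le_sum_min_degree {τ : ℝ} (hτ : 0 < τ)
    (hm : 2 * (G.edgeFinset.card : ℝ) ≤ τ ^ 2) :
    (G.edgeFinset.card : ℝ) ≤ ∑ v, min (G.degree v : ℝ) τ := by
  set A : V → V → ℝ := fun v u => if G.Adj v u then 1 else 0 with hA
  have hA0 : ∀ v u, 0 ≤ A v u := fun v u => by simp only [hA]; split_ifs <;> norm_num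
  have hA1 : ∀ v u, A v u ≤ 1 := fun v u => by simp only [hA]; split_ifs <;> norm_num
  have hAs : ∀ v u, A v u = A u v := fun v u => by simp only [hA, G.adj_comm]
  have hdeg : ∀ v, (G.degree v : ℝ) = ∑ u, A v u := fun v => by
    simp [hA, ← card_neighborFinset_eq_degree, neighborFinset_eq_filter]
  have htot : ∑ v, (G.degree v : ℝ) = 2 * G.edgeFinset.card := by
    exact_mod_cast G.sum_degrees_eq_twice_card_edges
  set S := Finset.univ.filter fun v => τ < G.degree v with hS
  have split : ∀ f : V → ℝ, ∑ v, f v = ∑ v ∈ S, f v + ∑ v ∈ Sᶜ, f v := fun f =>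
    (Finset.sum_add_sum_compl S f).symm
  have hlight : ∑ v ∈ Sᶜ, min (G.degree v : ℝ) τ = ∑ v ∈ Sᶜ, (G.degree v : ℝ) :=
    Finset.sum_congr rfl fun v hv => min_eq_left (by simpa [hS] using hv)
  have hheavy : ∑ v ∈ S, min (G.degree v : ℝ) τ = S.card * τ := by
    rw [← nsmul_eq_mul, ← Finset.sum_const]
    exact Finset.sum_congr rfl fun v hv => min_eq_right (by
      rw [hS, Finset.mem_filter] at hv
      exact hv.2.le)
  have hcard : S.card * τ ≤ 2 * G.edgeFinset.card := by
    rw [← htot, split, ← hheavy]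
    exact (Finset.sum_le_sum fun v _ => min_le_left _ _).trans
      (le_add_of_nonneg_right (Finset.sum_nonneg fun v _ => Nat.cast_nonneg _))
  have h1 : ∑ v ∈ S, (G.degree v : ℝ) ≤ S.card ^ 2 + ∑ v ∈ Sᶜ, (G.degree v : ℝ) := by
    simp only [hdeg]
    rw [Finset.sum_congr rfl fun v _ => split (A v), Finset.sum_add_distrib]
    refine add_le_add ?_ ?_
    · calc ∑ v ∈ S, ∑ u ∈ S, A v u ≤ ∑ v ∈ S, ∑ u ∈ S, 1 :=
            Finset.sum_le_sum fun v _ => Finset.sum_le_sum fun u _ => hA1 v u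
        _ = S.card ^ 2 := by simp [sq]
    · rw [Finset.sum_comm]
      refine Finset.sum_le_sum fun u _ => ?_
      rw [split (A u), Finset.sum_congr rfl fun v _ => hAs v u]
      exact le_add_of_nonneg_right (Finset.sum_nonneg fun v _ => hA0 u v)
  have h2 : (S.card : ℝ) ^ 2 ≤ S.card * τ := by
    have : (S.card : ℝ) ≤ τ := by
      have h3 : S.card * τ ≤ τ * τ := by rw [← sq]; exact hcard.trans hm
      exact le_of_mul_le_mul_right h3 hτ
    rw [sq]
    exact mul_le_mul_of_nonneg_left this (Nat.cast_nonneg _)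
  have h3 : ∑ v ∈ S, (G.degree v : ℝ) + ∑ v ∈ Sᶜ, (G.degree v : ℝ) = 2 * G.edgeFinset.card := by
    rw [← split, htot]
  have h4 : (0 : ℝ) ≤ S.card * τ := mul_nonneg (Nat.cast_nonneg _) hτ.le
  rw [split, hlight, hheavy]
  linarith

end SimpleGraph

namespace InputGraph

open Classical

variable (G : InputGraph)

theorem degree_pos (v : Fin G.n) : 0 < G.graph.degree v := by
  rw [SimpleGraph.degree_pos_iff_exists_adj]
  exact G.no_isolated v

@[simp]
theorem degreeOfId_id (v : Fin G.n) : G.degreeOfId (G.id v) = G.graph.degree v := by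
  simp [degreeOfId]

theorem avgDeg_eq : G.avgDeg = 2 * G.graph.edgeFinset.card / G.n := rfl

theorem sum_degree : ∑ v, (G.graph.degree v : ℝ) = 2 * G.graph.edgeFinset.card := by
  exact_mod_cast G.graph.sum_degrees_eq_twice_card_edges

theorem n_cast_pos : (0 : ℝ) < G.n := by exact_mod_cast G.n_pos

theorem card_edge_pos : (0 : ℝ) < G.graph.edgeFinset.card := by
  exact_mod_cast G.edgeFinset_nonempty.card_pos

theorem one_le_avgDeg : 1 ≤ G.avgDeg := by
  rw [avgDeg_eq, le_div_iff₀ G.n_cast_pos, one_mul, ← sum_degree]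
  calc (G.n : ℝ) = ∑ _v : Fin G.n, (1 : ℝ) := by simp
    _ ≤ _ := Finset.sum_le_sum fun v _ => by exact_mod_cast G.degree_pos v

theorem avgDeg_le_n : G.avgDeg ≤ G.n := by
  rw [avgDeg_eq, div_le_iff₀ G.n_cast_pos, ← sum_degree]
  calc _ ≤ ∑ _v : Fin G.n, (G.n : ℝ) := Finset.sum_le_sum fun v _ => by
        have h := (G.graph.degree_lt_card_verts v).le
        rw [Fintype.card_fin] at h
        exact_mod_cast h
    _ = _ := by simp

/-- The expectation of `vertexStat j`. -/
def vertexMean (j : ℕ) : ℝ := (∑ v, min ((G.graph.degree v : ℝ) / 2 ^ j) 1) / G.n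

/-- The expectation of `edgeStat j`. -/
def edgeMean (j : ℕ) : ℝ :=
  (∑ v, min (G.graph.degree v : ℝ) (2 ^ j)) / (2 * G.graph.edgeFinset.card)

theorem average_vertexStat (j : ℕ) :
    (∑ z, vertexStat j (G.roundSample z)) / Fintype.card G.RoundSpace = G.vertexMean j := by
  have := G.card_edge_pos
  have := G.n_cast_pos
  rw [Fintype.sum_prod_type, Fintype.card_prod, Fintype.card_fin, Fintype.card_coe]
  simp only [roundSample, vertexStat, degreeOfId_id, Finset.sum_const, Finset.card_univ,
    Fintype.card_coe, nsmul_eq_mul, ← Finset.mul_sum]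
  rw [vertexMean]
  push_cast
  field_simp

theorem degree_mul_min_eq (j : ℕ) (v : Fin G.n) :
    (G.graph.degree v : ℝ) * min 1 ((2 : ℝ) ^ j / G.graph.degree v) =
      min (G.graph.degree v : ℝ) (2 ^ j) := by
  have h : (0 : ℝ) < G.graph.degree v := by exact_mod_cast G.degree_pos v
  rw [mul_min_of_nonneg _ _ h.le, mul_one, mul_div_cancel₀ _ h.ne']

/-- The order of the endpoints chosen by `Quot.out` is arbitrary but immaterial, as the statistic is
symmetric. -/
theorem edgeStat_roundSample (j : ℕ) (z : G.RoundSpace) :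
    edgeStat j (G.roundSample z) =
      (∑ v ∈ z.2.1.toFinset, min 1 ((2 : ℝ) ^ j / G.graph.degree v)) / 2 := by
  obtain ⟨v, e, he⟩ := z
  induction e using Sym2.ind with
  | _ u w =>
    have hne : u ≠ w := by
      rw [SimpleGraph.mem_edgeFinset, SimpleGraph.mem_edgeSet] at he
      exact he.ne
    have hout : s((Quot.out (Sym2.map G.id s(u, w))).1, (Quot.out (Sym2.map G.id s(u, w))).2) =
        s(G.id u, G.id w) := Quot.out_eq _
    have hfin : (s(u, w) : Sym2 (Fin G.n)).toFinset = {u, w} := by ext; simp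
    simp only [edgeStat, roundSample, hfin, Finset.sum_pair hne]
    rcases Sym2.eq_iff.1 hout with ⟨h1, h2⟩ | ⟨h1, h2⟩
    · rw [h1, h2, degreeOfId_id, degreeOfId_id]
    · rw [h1, h2, degreeOfId_id, degreeOfId_id, add_comm]

theorem average_edgeStat (j : ℕ) :
    (∑ z, edgeStat j (G.roundSample z)) / Fintype.card G.RoundSpace = G.edgeMean j := by
  have := G.card_edge_pos
  have := G.n_cast_pos
  rw [Fintype.sum_prod_type, Fintype.card_prod, Fintype.card_fin, Fintype.card_coe]
  simp only [edgeStat_roundSample]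
  rw [Finset.sum_const, Finset.card_univ, Fintype.card_fin, nsmul_eq_mul, ← Finset.sum_div,
    Finset.sum_coe_sort G.graph.edgeFinset (fun e => ∑ v ∈ e.toFinset,
      min 1 ((2 : ℝ) ^ j / G.graph.degree v)), SimpleGraph.sum_edgeFinset_sum_toFinset]
  simp only [degree_mul_min_eq]
  rw [edgeMean]
  push_cast
  field_simp

theorem vertexMean_pos (j : ℕ) : 0 < G.vertexMean j := by
  refine div_pos (Finset.sum_pos (fun v _ => ?_) Finset.univ_nonempty) G.n_cast_pos
  have h : (0 : ℝ) < G.graph.degree v := by exact_mod_cast G.degree_pos v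
  exact lt_min (by positivity) one_pos

theorem vertexMean_le_one (j : ℕ) : G.vertexMean j ≤ 1 := by
  rw [vertexMean, div_le_one G.n_cast_pos]
  calc _ ≤ ∑ _v : Fin G.n, (1 : ℝ) := Finset.sum_le_sum fun v _ => min_le_right _ _
    _ = G.n := by simp

theorem edgeMean_pos (j : ℕ) : 0 < G.edgeMean j := by
  refine div_pos (Finset.sum_pos (fun v _ => ?_) Finset.univ_nonempty)
    (mul_pos two_pos G.card_edge_pos)
  exact lt_min (by exact_mod_cast G.degree_pos v) (by positivity)

theorem edgeMean_le_one (j : ℕ) : G.edgeMean j ≤ 1 := by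
  rw [edgeMean, div_le_one (mul_pos two_pos G.card_edge_pos), ← sum_degree]
  exact Finset.sum_le_sum fun v _ => min_le_left _ _

/-- Both sides equal `∑ min(deg, 2 ^ j) / n`. A random edge endpoint is a vertex drawn in proportion
to its degree, and the edge weight turns `deg` into `min(deg, 2 ^ j)`. -/
theorem avgDeg_mul_edgeMean (j : ℕ) : G.avgDeg * G.edgeMean j = 2 ^ j * G.vertexMean j := by
  have := G.card_edge_pos
  have := G.n_cast_pos
  have h : ∀ v, min (G.graph.degree v : ℝ) (2 ^ j) =
      2 ^ j * min ((G.graph.degree v : ℝ) / 2 ^ j) 1 := by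
    intro v
    rw [mul_min_of_nonneg _ _ (by positivity), mul_one, mul_div_cancel₀ _ (by positivity)]
  rw [avgDeg_eq, edgeMean, vertexMean, Finset.sum_congr rfl fun v _ => h v, ← Finset.mul_sum]
  field_simp

/-- All degrees are at least `1`, so at scale `1` the vertex statistic is constant. This is where
the absence of isolated vertices enters. -/
theorem vertexMean_zero : G.vertexMean 0 = 1 := by
  have h : ∀ v, min ((G.graph.degree v : ℝ) / 2 ^ 0) 1 = 1 := fun v =>
    min_eq_right (by rw [pow_zero, div_one]; exact_mod_cast G.degree_pos v)
  rw [vertexMean, Finset.sum_congr rfl fun v _ => h v]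
  simp [G.n_pos.ne']

theorem half_le_edgeMean {j : ℕ} (hj : 2 * (G.graph.edgeFinset.card : ℝ) ≤ 4 ^ j) :
    1 / 2 ≤ G.edgeMean j := by
  have h := G.graph.card_edgeFinset_le_sum_min_degree (τ := 2 ^ j) (by positivity) (by
    rw [← pow_mul, mul_comm j, pow_mul]; norm_num; exact hj)
  rw [edgeMean, le_div_iff₀ (mul_pos two_pos G.card_edge_pos)]
  linarith

/-- At a scale `2 ^ j` of order `√(2m)`, both means are at least of order `√(d / n)`. -/
theorem exists_scale : ∃ j : ℕ, ((j : ℝ) + 1) * (j + 2) ≤ 9 * (1 + Real.log G.n) ^ 2 ∧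
    1 ≤ 4 * √(G.n / G.avgDeg) * G.vertexMean j ∧ 1 ≤ 4 * √(G.n / G.avgDeg) * G.edgeMean j := by
  have hn := G.n_cast_pos
  have hm := G.card_edge_pos
  have hd := G.one_le_avgDeg
  have h2m : 2 * (G.graph.edgeFinset.card : ℝ) = G.avgDeg * G.n := by
    rw [avgDeg_eq]; field_simp
  have hex : ∃ j : ℕ, 2 * (G.graph.edgeFinset.card : ℝ) ≤ 4 ^ j :=
    (pow_unbounded_of_one_lt _ (by norm_num)).imp fun j hj => hj.le
  -- The least admissible scale: the upper bound on `2m` gives `edgeMean ≥ 1 / 2`, and minimality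
  -- keeps `2 ^ (j + 1)` below `2 √(2m)`.
  obtain ⟨j, hj, hmin⟩ : ∃ j : ℕ, 2 * (G.graph.edgeFinset.card : ℝ) ≤ 4 ^ (j + 1) ∧
      4 ^ j < 2 * (G.graph.edgeFinset.card : ℝ) := by
    have h1 := Nat.find_spec hex
    have h2 : Nat.find hex ≠ 0 := by
      intro h0
      rw [h0, pow_zero] at h1
      have : (1 : ℝ) ≤ G.graph.edgeFinset.card := by
        exact_mod_cast G.edgeFinset_nonempty.card_pos
      linarith
    obtain ⟨j, hj⟩ := Nat.exists_eq_succ_of_ne_zero h2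
    refine ⟨j, by rw [hj] at h1; exact h1, ?_⟩
    exact not_le.1 (Nat.find_min hex (m := j) (by omega))
  have hsq : (1 : ℝ) ≤ √(G.n / G.avgDeg) := by
    rw [Real.one_le_sqrt, le_div_iff₀ (by linarith), one_mul]
    exact G.avgDeg_le_n
  have hβ := G.half_le_edgeMean hj
  refine ⟨j + 1, ?_, ?_, by nlinarith⟩
  -- From `4 ^ j < 2m = d n ≤ n ^ 2`, the scale index is at most `(3 / 2) log n`, as `1 / log 2 < 3
  -- / 2`.
  · have h2n : (2 : ℝ) ^ j ≤ G.n := by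
      refine le_of_sq_le_sq ?_ hn.le
      calc ((2 : ℝ) ^ j) ^ 2 = 4 ^ j := by rw [← pow_mul, mul_comm j, pow_mul]; norm_num
        _ ≤ G.avgDeg * G.n := by rw [← h2m]; exact hmin.le
        _ ≤ G.n * G.n := by gcongr; exact G.avgDeg_le_n
        _ = _ := (sq _).symm
    have hlog := Real.log_le_log (by positivity) h2n
    rw [Real.log_pow] at hlog
    have hl2 := Real.log_two_gt_d9
    have hj0 : (0 : ℝ) ≤ j := j.cast_nonneg
    have hjL : (j : ℝ) ≤ 3 / 2 * Real.log G.n := by nlinarith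
    push_cast
    nlinarith
  · have hτ : (2 : ℝ) ^ (j + 1) ≤ 2 * √(G.avgDeg * G.n) := by
      have : (2 : ℝ) ^ j ≤ √(G.avgDeg * G.n) := by
        refine Real.le_sqrt_of_sq_le ?_
        rw [← h2m, ← pow_mul, mul_comm j, pow_mul]
        norm_num
        exact hmin.le
      rw [pow_succ]
      linarith
    have hsd : √(G.avgDeg * G.n) = G.avgDeg * √(G.n / G.avgDeg) := by
      rw [show G.avgDeg * G.n = G.avgDeg ^ 2 * (G.n / G.avgDeg) by
        field_simp, Real.sqrt_mul (by positivity), Real.sqrt_sq (by linarith)]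
    have hα := G.avgDeg_mul_edgeMean (j + 1)
    have h5 : G.avgDeg * (1 / 2) ≤ 2 * (G.avgDeg * √(G.n / G.avgDeg)) * G.vertexMean (j + 1) := by
      rw [← hsd]
      calc G.avgDeg * (1 / 2) ≤ G.avgDeg * G.edgeMean (j + 1) := by gcongr
        _ = 2 ^ (j + 1) * G.vertexMean (j + 1) := hα
        _ ≤ _ := by gcongr; exact (G.vertexMean_pos _).le
    have h6 : G.avgDeg * 1 ≤ G.avgDeg * (4 * √(G.n / G.avgDeg) * G.vertexMean (j + 1)) := by
      linarith
    exact le_of_mul_le_mul_left h6 (by linarith)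

end InputGraph

/-! ### Query budgets and the upper bound -/

theorem QueryAlgorithm.runFrom_mono (A : QueryAlgorithm) (G : InputGraph) (S : Set ℝ) (k : ℕ)
    (s : A.State) : (A.runFrom G k s).toOuterMeasure (some '' S) ≤
      (A.runFrom G (k + 1) s).toOuterMeasure (some '' S) := by
  induction k generalizing s with
  | zero =>
    cases hn : A.next s with
    | inl qf => simp [runFrom, hn, PMF.toOuterMeasure_pure_apply]
    | inr x => simp [runFrom, hn]
  | succ k ih =>
    cases hn : A.next s with
    | inl qf =>
      rw [A.runFrom_succ_of_next_eq_inl G k hn, A.runFrom_succ_of_next_eq_inl G (k + 1) hn]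
      simp only [PMF.toOuterMeasure_bind_apply]
      exact ENNReal.tsum_le_tsum fun r => mul_le_mul_right (ENNReal.tsum_le_tsum fun s' =>
        mul_le_mul_right (ih s') _) _
    | inr x => simp [runFrom, hn]

theorem QueryAlgorithm.probWithin_mono (A : QueryAlgorithm) (G : InputGraph) (S : Set ℝ) :
    Monotone fun k => A.probWithin G k S := by
  refine monotone_nat_of_le_succ fun k => ?_
  simp only [probWithin, PMF.toOuterMeasure_bind_apply]
  exact ENNReal.tsum_le_tsum fun s => mul_le_mul_right (A.runFrom_mono G S k s) _

/-- Some scale finishes after about `threshold * Y` rounds of five queries. The factor `10` instead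
of `5` absorbs both `1 + ε / 8` and the rounding of `k / 5`. -/
theorem lt_probWithin_degreeSampler (G : InputGraph) {ε : ℝ} (h0 : 0 < ε) (h1 : ε < 1) {k j : ℕ}
    {Y : ℝ} (hY : 1 ≤ Y) (hα : 1 ≤ Y * G.vertexMean j) (hβ : 1 ≤ Y * G.edgeMean j)
    (hk : 10 * threshold ε j * Y ≤ k) :
    99 / 100 < (degreeSampler (stoppingRule ε)).probWithin G k
      {x | |x - G.avgDeg| ≤ ε * G.avgDeg} := by
  have hU := succ_le_threshold h0 h1 j
  have hj0 : (0 : ℝ) ≤ j := j.cast_nonneg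
  have hkT : (k : ℝ) ≤ 5 * (k / 5 : ℕ) + 5 := by
    have : k ≤ 5 * (k / 5) + 5 := by omega
    exact_mod_cast this
  have hT : threshold ε j * (1 + ε / 8) * Y ≤ (k / 5 : ℕ) := by
    have h2 : threshold ε j ≤ threshold ε j * Y :=
      le_mul_of_one_le_right (threshold_pos h0 j).le hY
    nlinarith
  have hceil : ∀ μ : ℝ, 0 < μ → 1 ≤ Y * μ →
      ⌈threshold ε j * (1 + ε / 8) / μ⌉₊ ≤ k / 5 := by
    intro μ hμ h
    refine Nat.ceil_le.2 (le_trans ?_ hT)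
    rw [div_le_iff₀ hμ, mul_assoc _ Y]
    exact le_mul_of_one_le_right (mul_nonneg (threshold_pos h0 j).le (by linarith)) h
  have h2 := lt_roundProb_stoppingRule G.roundSample h0 h1 (by linarith [G.one_le_avgDeg])
    G.average_vertexStat G.average_edgeStat G.vertexMean_pos G.vertexMean_le_one
    G.edgeMean_pos G.edgeMean_le_one G.avgDeg_mul_edgeMean (hceil _ (G.vertexMean_pos j) hα)
    (hceil _ (G.edgeMean_pos j) hβ)
  have h3 := ofReal_roundProb_le_probWithin G (stoppingRule ε)
    {x | |x - G.avgDeg| ≤ ε * G.avgDeg} (k / 5)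
  refine lt_of_lt_of_le ?_ (h3.trans ((degreeSampler (stoppingRule ε)).probWithin_mono G _
    (show 5 * (k / 5) ≤ k by omega)))
  have h4 : (99 / 100 : ℝ≥0∞) = ENNReal.ofReal (99 / 100) := by
    rw [ENNReal.ofReal_div_of_pos (by norm_num)]
    norm_num
  rw [h4]
  exact (ENNReal.ofReal_lt_ofReal_iff (by linarith)).2 h2

theorem upper_bound :
    ∃ (C : ℝ) (p : ℕ), 0 < C ∧ ∀ ε : ℝ, 0 < ε → ε < 1 →
      ∃ A : QueryAlgorithm, A.InBaseModelWithRandEdge ∧ ∀ G : InputGraph,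
        99 / 100 < A.probWithin G
            ⌊C * (1 + Real.log G.n) ^ p *
              (ε⁻¹ ^ 2 * min G.avgDeg (Real.sqrt (G.n / G.avgDeg)))⌋₊
            {x | |x - G.avgDeg| ≤ ε * G.avgDeg} ∧
        99 / 100 < A.probWithin G
            ⌊C * (1 + Real.log G.n) ^ p * (ε⁻¹ ^ 2 * (G.n : ℝ) ^ (1 / 3 : ℝ))⌋₊
            {x | |x - G.avgDeg| ≤ ε * G.avgDeg} := by
  -- The exponent `2` comes from the factor `(j + 1)(j + 2)` with `j = O(1 + log n)`. The constant
  -- exceeds `10 * 102400 * 9 * 4` with room for the floor.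
  refine ⟨10 ^ 8, 2, by norm_num, fun ε h0 h1 =>
    ⟨degreeSampler (stoppingRule ε), degreeSampler_inBaseModel _, fun G => ?_⟩⟩
  have hd := G.one_le_avgDeg
  have hn : (1 : ℝ) ≤ G.n := by exact_mod_cast G.n_pos
  have hL : 0 ≤ Real.log G.n := Real.log_nonneg hn
  have hsq : (1 : ℝ) ≤ √(G.n / G.avgDeg) := by
    rw [Real.one_le_sqrt, le_div_iff₀ (by linarith), one_mul]
    exact G.avgDeg_le_n
  have hε : 1 ≤ ε⁻¹ ^ 2 := one_le_pow₀ ((one_le_inv₀ h0).2 h1.le)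
  have main : 99 / 100 < (degreeSampler (stoppingRule ε)).probWithin G
      ⌊10 ^ 8 * (1 + Real.log G.n) ^ 2 *
        (ε⁻¹ ^ 2 * min G.avgDeg (Real.sqrt (G.n / G.avgDeg)))⌋₊
      {x | |x - G.avgDeg| ≤ ε * G.avgDeg} := by
    have hthr : ∀ j, threshold ε j = 102400 * ((j + 1) * (j + 2)) * ε⁻¹ ^ 2 := fun j => by
      rw [threshold, div_eq_mul_inv, inv_pow]
    have hLs : 1 ≤ (1 + Real.log G.n) ^ 2 := one_le_pow₀ (by linarith)
    rcases le_total G.avgDeg √(G.n / G.avgDeg) with h | h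
    · rw [min_eq_left h]
      have hα := G.vertexMean_zero
      have hβ := G.avgDeg_mul_edgeMean 0
      rw [hα, pow_zero, mul_one] at hβ
      refine lt_probWithin_degreeSampler G h0 h1 (j := 0) hd (by rw [hα]; linarith) hβ.ge ?_
      refine le_trans ?_ (Nat.sub_one_lt_floor _).le
      rw [hthr]
      have h2 : 1 ≤ ε⁻¹ ^ 2 * G.avgDeg := one_le_mul_of_one_le_of_one_le hε hd
      have h3 := mul_le_mul_of_nonneg_right hLs (zero_le_one.trans h2)
      push_cast
      nlinarith
    · rw [min_eq_right h]
      obtain ⟨j, hj, hα, hβ⟩ := G.exists_scale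
      refine lt_probWithin_degreeSampler G h0 h1 (j := j) (by linarith) hα hβ ?_
      refine le_trans ?_ (Nat.sub_one_lt_floor _).le
      rw [hthr]
      have h2 : 1 ≤ ε⁻¹ ^ 2 * √(G.n / G.avgDeg) := one_le_mul_of_one_le_of_one_le hε hsq
      have h3 := mul_le_mul_of_nonneg_right hLs (zero_le_one.trans h2)
      have h4 := mul_le_mul_of_nonneg_right hj (zero_le_one.trans h2)
      nlinarith
  refine ⟨main, main.trans_le ((degreeSampler (stoppingRule ε)).probWithin_mono G _ ?_)⟩
  gcongr
  -- The two terms of the minimum balance at `d = n ^ (1/3)`: above it, `n / d ≤ n ^ (2/3)`.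
  rcases le_total G.avgDeg ((G.n : ℝ) ^ (1 / 3 : ℝ)) with h | h
  · exact (min_le_left _ _).trans h
  · refine (min_le_right _ _).trans ((Real.sqrt_le_left (by positivity)).2 ?_)
    rw [div_le_iff₀ (by linarith), ← Real.rpow_natCast, ← Real.rpow_mul (by positivity)]
    calc (G.n : ℝ) = (G.n : ℝ) ^ (1 / 3 * ((2 : ℕ) : ℝ)) * (G.n : ℝ) ^ (1 / 3 : ℝ) := by
          rw [← Real.rpow_add (by linarith)]
          norm_num
      _ ≤ _ := by gcongr

end

/-! ### Probabilities of events for truncated runs -/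

noncomputable section

theorem PMF.uniformOfFinset_map_embedding {α β : Type*} (s : Finset α) (hs : s.Nonempty)
    (f : α ↪ β) :
    (PMF.uniformOfFinset s hs).map f = PMF.uniformOfFinset (s.map f) (hs.map) := by
  apply PMF.toOuterMeasure_injective
  refine MeasureTheory.OuterMeasure.ext fun X => ?_
  rw [← PMF.bind_pure_comp, PMF.toOuterMeasure_uniformOfFinset_bind,
    ← PMF.bind_pure (PMF.uniformOfFinset (s.map f) _), PMF.toOuterMeasure_uniformOfFinset_bind,
    Finset.sum_map, Finset.card_map]
  rfl

theorem PMF.toOuterMeasure_le_one {α : Type*} (p : PMF α) (X : Set α) :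
    p.toOuterMeasure X ≤ 1 :=
  (p.toOuterMeasure.mono (Set.subset_univ X)).trans_eq
    ((p.toOuterMeasure_apply_eq_one_iff Set.univ).2 (Set.subset_univ _))

theorem PMF.toOuterMeasure_add_compl {α : Type*} (p : PMF α) (X : Set α) :
    p.toOuterMeasure X + p.toOuterMeasure Xᶜ = 1 := by
  rw [PMF.toOuterMeasure_apply, PMF.toOuterMeasure_apply, ← ENNReal.tsum_add, ← p.tsum_coe]
  exact tsum_congr fun a => Set.indicator_self_add_compl_apply X p a

theorem PMF.toOuterMeasure_add_le_of_disjoint {α : Type*} (p : PMF α) {X Y Z : Set α}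
    (h : Disjoint X Y) (hX : X ⊆ Z) (hY : Y ⊆ Z) :
    p.toOuterMeasure X + p.toOuterMeasure Y ≤ p.toOuterMeasure Z := by
  rw [PMF.toOuterMeasure_apply, PMF.toOuterMeasure_apply, ← ENNReal.tsum_add]
  rw [PMF.toOuterMeasure_apply]
  refine ENNReal.tsum_le_tsum fun a => ?_
  by_cases haX : a ∈ X
  · simp [haX, hX haX, Set.disjoint_left.1 h haX]
  · by_cases haY : a ∈ Y
    · simp [haX, haY, hY haY]
    · simp [haX, haY]

/-- The three processes share the first step `p`, and the constant `1` is its total mass. This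
carries inclusion–exclusion bounds through a common random choice. -/
theorem PMF.toOuterMeasure_bind_add_le {α β : Type*} (p : PMF α) {f g h : α → PMF β}
    {X Y Z : Set β} (H : ∀ a, (f a).toOuterMeasure X + (g a).toOuterMeasure Y ≤
      1 + (h a).toOuterMeasure Z) :
    (p.bind f).toOuterMeasure X + (p.bind g).toOuterMeasure Y ≤
      1 + (p.bind h).toOuterMeasure Z := by
  simp only [PMF.toOuterMeasure_bind_apply]
  conv_rhs => rw [← p.tsum_coe]
  rw [← ENNReal.tsum_add, ← ENNReal.tsum_add]
  refine ENNReal.tsum_le_tsum fun a => ?_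
  rw [← mul_add]
  calc p a * _ ≤ p a * (1 + (h a).toOuterMeasure Z) := mul_le_mul_right (H a) _
    _ = _ := by rw [mul_add, mul_one]

namespace QueryAlgorithm

variable (A : QueryAlgorithm) (G : InputGraph)

theorem runFrom_of_next_eq_inr {s : A.State} {x : ℝ} (h : A.next s = .inr x) (k : ℕ) :
    A.runFrom G k s = PMF.pure (some x) := by
  cases k <;> simp [runFrom, h]

theorem runFrom_zero_of_next_eq_inl {s : A.State} {qf} (h : A.next s = .inl qf) :
    A.runFrom G 0 s = PMF.pure none := by
  simp [runFrom, h]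

theorem runFrom_add_runFrom_le (S : Set ℝ) (k k' : ℕ) (s : A.State) :
    (A.runFrom G k' s).toOuterMeasure (some '' S) +
      (A.runFrom G k s).toOuterMeasure (some '' Set.univ) ≤
      1 + (A.runFrom G k s).toOuterMeasure (some '' S) := by
  induction k generalizing k' s with
  | zero =>
    cases hn : A.next s with
    | inr x =>
      rw [A.runFrom_of_next_eq_inr G hn, A.runFrom_of_next_eq_inr G hn, add_comm]
      gcongr
      exact PMF.toOuterMeasure_le_one _ _
    | inl qf =>
      have : (A.runFrom G 0 s).toOuterMeasure (some '' Set.univ) = 0 := by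
        rw [A.runFrom_zero_of_next_eq_inl G hn, PMF.toOuterMeasure_pure_apply]
        simp
      rw [this, add_zero]
      exact (PMF.toOuterMeasure_le_one _ _).trans le_self_add
  | succ k ih =>
    cases hn : A.next s with
    | inr x =>
      rw [A.runFrom_of_next_eq_inr G hn, A.runFrom_of_next_eq_inr G hn, add_comm]
      gcongr
      exact PMF.toOuterMeasure_le_one _ _
    | inl qf =>
      cases k' with
      | zero =>
        have : (A.runFrom G 0 s).toOuterMeasure (some '' S) = 0 := by
          rw [A.runFrom_zero_of_next_eq_inl G hn, PMF.toOuterMeasure_pure_apply]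
          simp
        rw [this, zero_add]
        exact (PMF.toOuterMeasure_le_one _ _).trans le_self_add
      | succ k' =>
        rw [A.runFrom_succ_of_next_eq_inl G k hn, A.runFrom_succ_of_next_eq_inl G k' hn]
        exact PMF.toOuterMeasure_bind_add_le _ fun r =>
          PMF.toOuterMeasure_bind_add_le _ fun s' => ih k' s'

theorem prob_add_probWithin_le (S : Set ℝ) (k : ℕ) :
    A.prob G S + A.probWithin G k Set.univ ≤ 1 + A.probWithin G k S := by
  rw [prob, ENNReal.iSup_add]
  exact iSup_le fun k' => PMF.toOuterMeasure_bind_add_le _ fun s =>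
    A.runFrom_add_runFrom_le G S k k' s

theorem probWithin_add_prob_le {S S' : Set ℝ} (h : Disjoint S S') (k : ℕ) :
    A.probWithin G k S + A.prob G S' ≤ 1 := by
  have h1 := A.prob_add_probWithin_le G S' k
  have h2 : A.probWithin G k S + A.probWithin G k S' ≤ A.probWithin G k Set.univ :=
    PMF.toOuterMeasure_add_le_of_disjoint _
      ((Set.disjoint_image_iff (Option.some_injective _)).2 h)
      (Set.image_mono (Set.subset_univ _)) (Set.image_mono (Set.subset_univ _))
  have h3 : A.probWithin G k S' ≠ ⊤ :=
    ((PMF.toOuterMeasure_le_one _ _).trans_lt ENNReal.one_lt_top).ne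
  refine (ENNReal.add_le_add_iff_right h3).1 (le_trans ?_ h1)
  calc _ = A.prob G S' + (A.probWithin G k S + A.probWithin G k S') := by ring
    _ ≤ _ := by gcongr

end QueryAlgorithm

/-! ### Input graphs induced on sets of identifiers -/

namespace InputGraph

/-- The identifiers of the vertices of `G`. -/
def idFinset (G : InputGraph) : Finset ℕ := Finset.univ.map G.id

theorem mem_idFinset {G : InputGraph} {x : ℕ} : x ∈ G.idFinset ↔ ∃ v, G.id v = x := by
  simp [idFinset]

theorem card_idFinset (G : InputGraph) : G.idFinset.card = G.n := by simp [idFinset]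

/-- The adjacency of `G` is that of a graph `H` on the universe of identifiers. -/
def InducedFrom (G : InputGraph) (H : SimpleGraph ℕ) : Prop :=
  ∀ u v, G.graph.Adj u v ↔ H.Adj (G.id u) (G.id v)

/-- The input graph that `H` induces on a finite set of identifiers. -/
def ofFinset (H : SimpleGraph ℕ) (V : Finset ℕ) (hV : V.Nonempty)
    (hiso : ∀ x ∈ V, ∃ y ∈ V, H.Adj x y) : InputGraph where
  n := V.card
  n_pos := hV.card_pos
  graph := H.comap (V.orderEmbOfFin rfl)
  no_isolated v := by
    obtain ⟨y, hy, hxy⟩ := hiso _ (V.orderEmbOfFin_mem rfl v)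
    have : y ∈ Set.range (V.orderEmbOfFin rfl) := by rwa [Finset.range_orderEmbOfFin]
    obtain ⟨w, rfl⟩ := this
    exact ⟨w, hxy⟩
  id := (V.orderEmbOfFin rfl).toEmbedding

theorem idFinset_ofFinset (H : SimpleGraph ℕ) (V : Finset ℕ) (hV : V.Nonempty)
    (hiso : ∀ x ∈ V, ∃ y ∈ V, H.Adj x y) : (ofFinset H V hV hiso).idFinset = V := by
  ext x
  have h : x ∈ Set.range (V.orderEmbOfFin rfl) ↔ x ∈ V := by
    rw [Finset.range_orderEmbOfFin]; rfl
  rw [mem_idFinset, ← h]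
  rfl

theorem inducedFrom_ofFinset (H : SimpleGraph ℕ) (V : Finset ℕ) (hV : V.Nonempty)
    (hiso : ∀ x ∈ V, ∃ y ∈ V, H.Adj x y) : (ofFinset H V hV hiso).InducedFrom H :=
  fun _ _ => Iff.rfl

theorem vertex_eq_none {G : InputGraph} {x : ℕ} (h : x ∉ G.idFinset) : G.vertex x = none := by
  cases hv : G.vertex x with
  | none => rfl
  | some v =>
    refine absurd (mem_idFinset.2 ⟨v, ?_⟩) h
    rw [vertex, Function.partialInv] at hv
    split_ifs at hv with h'
    rw [← Option.some.inj hv]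
    exact h'.choose_spec

open Classical in
theorem InducedFrom.map_neighborFinset {G : InputGraph} {H : SimpleGraph ℕ} (hG : G.InducedFrom H)
    (v : Fin G.n) :
    (G.graph.neighborFinset v).map G.id = G.idFinset.filter (H.Adj (G.id v)) := by
  ext y
  simp only [Finset.mem_map, SimpleGraph.mem_neighborFinset, Finset.mem_filter, mem_idFinset]
  constructor
  · rintro ⟨w, hw, rfl⟩
    exact ⟨⟨w, rfl⟩, (hG _ _).1 hw⟩
  · rintro ⟨⟨w, rfl⟩, hw⟩
    exact ⟨w, (hG _ _).2 hw, rfl⟩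

open Classical in
theorem InducedFrom.degree_eq {G : InputGraph} {H : SimpleGraph ℕ} (hG : G.InducedFrom H)
    (v : Fin G.n) : G.graph.degree v = (G.idFinset.filter (H.Adj (G.id v))).card := by
  rw [← hG.map_neighborFinset, Finset.card_map, SimpleGraph.card_neighborFinset_eq_degree]

open Classical in
theorem InducedFrom.filter_nonempty {G : InputGraph} {H : SimpleGraph ℕ} (hG : G.InducedFrom H)
    {x : ℕ} (hx : x ∈ G.idFinset) : (G.idFinset.filter (H.Adj x)).Nonempty := by
  obtain ⟨v, rfl⟩ := mem_idFinset.1 hx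
  rw [← hG.map_neighborFinset]
  exact (G.neighborFinset_nonempty v).map

open Classical in
theorem InducedFrom.answer_randNbr {G : InputGraph} {H : SimpleGraph ℕ} (hG : G.InducedFrom H)
    {x : ℕ} (hx : x ∈ G.idFinset) : G.answer (.randNbr x) =
      (PMF.uniformOfFinset _ (hG.filter_nonempty hx)).map some := by
  obtain ⟨v, rfl⟩ := mem_idFinset.1 hx
  have h : G.answer (.randNbr (G.id v)) =
      (PMF.uniformOfFinset _ (G.neighborFinset_nonempty v)).map (fun w => some (G.id w)) := by
    simp only [answer, vertex_id]
    rfl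
  rw [h]
  have h2 := PMF.uniformOfFinset_map_embedding _ (G.neighborFinset_nonempty v) G.id
  simp only [hG.map_neighborFinset v] at h2
  rw [← h2, PMF.map_comp]
  rfl

theorem answer_randNbr_of_notMem {G : InputGraph} {x : ℕ} (h : x ∉ G.idFinset) :
    G.answer (.randNbr x) = PMF.pure none := by
  simp only [answer, vertex_eq_none h]
  rfl

theorem answer_degree_of_notMem {G : InputGraph} {x : ℕ} (h : x ∉ G.idFinset) :
    G.answer (.degree x) = PMF.pure none := by
  simp only [answer, vertex_eq_none h, Option.map_none]
  rfl

theorem answer_fullNbrHood_of_notMem {G : InputGraph} {x : ℕ} (h : x ∉ G.idFinset) :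
    G.answer (.fullNbrHood x) = PMF.pure none := by
  simp only [answer, vertex_eq_none h, Option.map_none]
  rfl

open Classical in
theorem InducedFrom.answer_degree {G : InputGraph} {H : SimpleGraph ℕ} (hG : G.InducedFrom H)
    {x : ℕ} (hx : x ∈ G.idFinset) : G.answer (.degree x) =
      PMF.pure (some (G.idFinset.filter (H.Adj x)).card) := by
  obtain ⟨v, rfl⟩ := mem_idFinset.1 hx
  simp only [answer, vertex_id, Option.map_some, hG.degree_eq]
  rfl

open Classical in
theorem InducedFrom.answer_fullNbrHood {G : InputGraph} {H : SimpleGraph ℕ}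
    (hG : G.InducedFrom H) {x : ℕ} (hx : x ∈ G.idFinset) : G.answer (.fullNbrHood x) =
      PMF.pure (some (G.idFinset.filter (H.Adj x))) := by
  obtain ⟨v, rfl⟩ := mem_idFinset.1 hx
  simp only [answer, vertex_id, Option.map_some, hG.map_neighborFinset]
  rfl

open Classical in
theorem InducedFrom.answer_pair {G : InputGraph} {H : SimpleGraph ℕ} (hG : G.InducedFrom H)
    (x y : ℕ) : G.answer (.pair x y) =
      PMF.pure (decide (x ∈ G.idFinset ∧ y ∈ G.idFinset ∧ H.Adj x y)) := by
  simp only [answer]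
  congr 2
  simp only [mem_idFinset, eq_iff_iff]
  constructor
  · rintro ⟨u, v, rfl, rfl, h⟩
    exact ⟨⟨u, rfl⟩, ⟨v, rfl⟩, (hG _ _).1 h⟩
  · rintro ⟨⟨u, rfl⟩, ⟨v, rfl⟩, h⟩
    exact ⟨u, v, rfl, rfl, (hG _ _).2 h⟩

/-- The answers to queries about one vertex only depend on the part of the graph around it. -/
theorem InducedFrom.answer_congr {G G' : InputGraph} {H : SimpleGraph ℕ} (hG : G.InducedFrom H)
    (hG' : G'.InducedFrom H) {x : ℕ}
    (hx : ∀ y, (y = x ∨ H.Adj x y) → (y ∈ G.idFinset ↔ y ∈ G'.idFinset)) :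
    G.answer (.randNbr x) = G'.answer (.randNbr x) ∧ G.answer (.degree x) = G'.answer (.degree x) ∧
      G.answer (.fullNbrHood x) = G'.answer (.fullNbrHood x) := by
  classical
  by_cases h : x ∈ G.idFinset
  · have h' := (hx x (Or.inl rfl)).1 h
    have hf : G.idFinset.filter (H.Adj x) = G'.idFinset.filter (H.Adj x) := by
      ext y
      simp only [Finset.mem_filter]
      exact and_congr_left fun hy => hx y (Or.inr hy)
    have hu : ∀ (s s' : Finset ℕ) (hs : s.Nonempty) (hs' : s'.Nonempty), s = s' →
        (PMF.uniformOfFinset s hs).map some = (PMF.uniformOfFinset s' hs').map some := by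
      rintro s _ hs hs' rfl
      rfl
    refine ⟨(hG.answer_randNbr h).trans ((hu _ _ _ _ hf).trans (hG'.answer_randNbr h').symm),
      (hG.answer_degree h).trans (Eq.trans ?_ (hG'.answer_degree h').symm),
      (hG.answer_fullNbrHood h).trans (Eq.trans ?_ (hG'.answer_fullNbrHood h').symm)⟩ <;> rw [hf]
  · have h' := fun h' => h ((hx x (Or.inl rfl)).2 h')
    rw [answer_randNbr_of_notMem h, answer_randNbr_of_notMem h', answer_degree_of_notMem h,
      answer_degree_of_notMem h', answer_fullNbrHood_of_notMem h, answer_fullNbrHood_of_notMem h']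
    exact ⟨rfl, rfl, rfl⟩

theorem toOuterMeasure_answer_randVert_bind (G : InputGraph) {β : Type*} (f : ℕ → PMF β)
    (X : Set β) : ((G.answer .randVert).bind f).toOuterMeasure X =
      (∑ x ∈ G.idFinset, (f x).toOuterMeasure X) / G.n := by
  change (((PMF.uniformOfFinset Finset.univ Finset.univ_nonempty).map G.id).bind
    f).toOuterMeasure X = _
  rw [PMF.bind_map, PMF.toOuterMeasure_uniformOfFinset_bind]
  simp [idFinset]

open Classical in
theorem toOuterMeasure_answer_randEdge_bind (G : InputGraph) {β : Type*} (f : Sym2 ℕ → PMF β)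
    (X : Set β) : ((G.answer .randEdge).bind f).toOuterMeasure X =
      (∑ e ∈ G.graph.edgeFinset, (f (Sym2.map G.id e)).toOuterMeasure X) /
        G.graph.edgeFinset.card := by
  change (((PMF.uniformOfFinset G.graph.edgeFinset G.edgeFinset_nonempty).map
    (Sym2.map G.id)).bind f).toOuterMeasure X = _
  rw [PMF.bind_map, PMF.toOuterMeasure_uniformOfFinset_bind]
  rfl

end InputGraph

end

/-! ### The hard instances: a clique with a matching -/

noncomputable section

section CliqueWithMatching

/-- The graph on `ℕ` that consists of a clique on `{0, …, h - 1}` and of the edges between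
`h + 2 * i` and `h + 2 * i + 1`. -/
def cliqueMatching (h : ℕ) : SimpleGraph ℕ where
  Adj x y := x ≠ y ∧ ((x < h ∧ y < h) ∨ (h ≤ x ∧ h ≤ y ∧ (x - h) / 2 = (y - h) / 2))
  symm := ⟨fun x y => by
    rintro ⟨h1, h2 | ⟨h2, h3, h4⟩⟩
    · exact ⟨h1.symm, Or.inl ⟨h2.2, h2.1⟩⟩
    · exact ⟨h1.symm, Or.inr ⟨h3, h2, h4.symm⟩⟩⟩
  loopless := ⟨fun x hx => hx.1 rfl⟩

theorem cliqueMatching_adj {h x y : ℕ} : (cliqueMatching h).Adj x y ↔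
    x ≠ y ∧ ((x < h ∧ y < h) ∨ (h ≤ x ∧ h ≤ y ∧ (x - h) / 2 = (y - h) / 2)) := Iff.rfl

/-- The vertices of the clique together with the matching edges with index in `I`. -/
def cliqueMatchingIds (h : ℕ) (I : Finset ℕ) : Finset ℕ :=
  Finset.range h ∪ I.biUnion fun i => {h + 2 * i, h + 2 * i + 1}

theorem mem_cliqueMatchingIds {h x : ℕ} {I : Finset ℕ} :
    x ∈ cliqueMatchingIds h I ↔ x < h ∨ (h ≤ x ∧ (x - h) / 2 ∈ I) := by
  simp only [cliqueMatchingIds, Finset.mem_union, Finset.mem_range, Finset.mem_biUnion,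
    Finset.mem_insert, Finset.mem_singleton]
  constructor
  · rintro (hx | ⟨i, hi, rfl | rfl⟩)
    · exact Or.inl hx
    · exact Or.inr ⟨by omega, by rwa [show (h + 2 * i - h) / 2 = i by omega]⟩
    · exact Or.inr ⟨by omega, by rwa [show (h + 2 * i + 1 - h) / 2 = i by omega]⟩
  · rintro (hx | ⟨hx, hi⟩)
    · exact Or.inl hx
    · exact Or.inr ⟨_, hi, by omega⟩

theorem sum_cliqueMatchingIds {β : Type*} [AddCommMonoid β] (h : ℕ) (I : Finset ℕ) (F : ℕ → β) :
    ∑ x ∈ cliqueMatchingIds h I, F x =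
      ∑ x ∈ Finset.range h, F x + ∑ i ∈ I, (F (h + 2 * i) + F (h + 2 * i + 1)) := by
  rw [cliqueMatchingIds, Finset.sum_union, Finset.sum_biUnion]
  · congr 1
    refine Finset.sum_congr rfl fun i _ => Finset.sum_pair (by omega)
  · intro i _ j _ hij
    simp only [Function.onFun, Finset.disjoint_left, Finset.mem_insert, Finset.mem_singleton]
    omega
  · simp only [Finset.disjoint_left, Finset.mem_range, Finset.mem_biUnion, Finset.mem_insert,
      Finset.mem_singleton, not_exists, not_and]
    intro a ha i _
    omega

variable {h : ℕ} (hh : 2 ≤ h)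

/-- The input graph that consists of a clique on `h` vertices and a matching indexed by `I`. -/
def cliqueMatchingInput (I : Finset ℕ) : InputGraph :=
  InputGraph.ofFinset (cliqueMatching h) (cliqueMatchingIds h I)
    ⟨0, mem_cliqueMatchingIds.2 (Or.inl (by omega))⟩ (by
      intro x hx
      rcases mem_cliqueMatchingIds.1 hx with hx | ⟨hx, hi⟩
      · refine ⟨if x = 0 then 1 else 0, mem_cliqueMatchingIds.2 (Or.inl ?_), ?_⟩
        · split_ifs <;> omega
        · rw [cliqueMatching_adj]
          split_ifs <;> omega
      · rcases Nat.mod_two_eq_zero_or_one (x - h) with hm | hm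
        · refine ⟨x + 1, mem_cliqueMatchingIds.2 (Or.inr ⟨by omega, ?_⟩), ?_⟩
          · rwa [show (x + 1 - h) / 2 = (x - h) / 2 by omega]
          · rw [cliqueMatching_adj]
            omega
        · refine ⟨x - 1, mem_cliqueMatchingIds.2 (Or.inr ⟨by omega, ?_⟩), ?_⟩
          · rwa [show (x - 1 - h) / 2 = (x - h) / 2 by omega]
          · rw [cliqueMatching_adj]
            omega)

theorem idFinset_cliqueMatchingInput (I : Finset ℕ) :
    (cliqueMatchingInput hh I).idFinset = cliqueMatchingIds h I :=
  InputGraph.idFinset_ofFinset _ _ _ _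

theorem inducedFrom_cliqueMatchingInput (I : Finset ℕ) :
    (cliqueMatchingInput hh I).InducedFrom (cliqueMatching h) :=
  InputGraph.inducedFrom_ofFinset _ _ _ _

theorem n_cliqueMatchingInput (I : Finset ℕ) :
    (cliqueMatchingInput hh I).n = h + 2 * I.card := by
  rw [← InputGraph.card_idFinset, idFinset_cliqueMatchingInput, Finset.card_eq_sum_ones,
    sum_cliqueMatchingIds]
  simp [mul_comm]

open Classical in
theorem two_mul_card_edgeFinset_cliqueMatchingInput (I : Finset ℕ) :
    2 * (cliqueMatchingInput hh I).graph.edgeFinset.card = h * (h - 1) + 2 * I.card := by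
  rw [← SimpleGraph.sum_degrees_eq_twice_card_edges]
  simp only [(inducedFrom_cliqueMatchingInput hh I).degree_eq, idFinset_cliqueMatchingInput]
  have h1 := Finset.sum_map (Finset.univ : Finset (Fin (cliqueMatchingInput hh I).n))
    (cliqueMatchingInput hh I).id (fun x =>
      ((cliqueMatchingIds h I).filter ((cliqueMatching h).Adj x)).card)
  refine h1.symm.trans ?_
  change ∑ x ∈ (cliqueMatchingInput hh I).idFinset, _ = _
  rw [idFinset_cliqueMatchingInput, sum_cliqueMatchingIds]
  have c1 : ∀ x ∈ Finset.range h,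
      ((cliqueMatchingIds h I).filter ((cliqueMatching h).Adj x)).card = h - 1 := by
    intro x hx
    have : (cliqueMatchingIds h I).filter ((cliqueMatching h).Adj x) = (Finset.range h).erase x := by
      ext y
      rw [Finset.mem_range] at hx
      simp only [Finset.mem_filter, mem_cliqueMatchingIds, cliqueMatching_adj, Finset.mem_erase,
        Finset.mem_range]
      omega
    rw [this, Finset.card_erase_of_mem hx, Finset.card_range]
  have c2 : ∀ i ∈ I,
      ((cliqueMatchingIds h I).filter ((cliqueMatching h).Adj (h + 2 * i))).card = 1 := by
    intro i hi
    rw [Finset.card_eq_one]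
    refine ⟨h + 2 * i + 1, ?_⟩
    ext y
    simp only [Finset.mem_filter, mem_cliqueMatchingIds, cliqueMatching_adj, Finset.mem_singleton]
    constructor
    · omega
    · rintro rfl
      exact ⟨Or.inr ⟨by omega, by rwa [show (h + 2 * i + 1 - h) / 2 = i by omega]⟩, by omega⟩
  have c3 : ∀ i ∈ I,
      ((cliqueMatchingIds h I).filter ((cliqueMatching h).Adj (h + 2 * i + 1))).card = 1 := by
    intro i hi
    rw [Finset.card_eq_one]
    refine ⟨h + 2 * i, ?_⟩
    ext y
    simp only [Finset.mem_filter, mem_cliqueMatchingIds, cliqueMatching_adj, Finset.mem_singleton]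
    constructor
    · omega
    · rintro rfl
      exact ⟨Or.inr ⟨by omega, by rwa [show (h + 2 * i - h) / 2 = i by omega]⟩, by omega⟩
  rw [Finset.sum_congr rfl c1,
    Finset.sum_congr rfl fun i hi => congrArg₂ (· + ·) (c2 i hi) (c3 i hi)]
  simp [mul_comm]

/-- The index of the matching edge that a query is about. -/
def touchedIndex (h : ℕ) : Query → Option ℕ
  | .randVert => none
  | .randEdge => none
  | .randNbr x => if h ≤ x then some ((x - h) / 2) else none
  | .degree x => if h ≤ x then some ((x - h) / 2) else none
  | .pair x _ => if h ≤ x then some ((x - h) / 2) else none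
  | .fullNbrHood x => if h ≤ x then some ((x - h) / 2) else none

/-- The clique is always present, and a matching vertex has a neighborhood inside its own edge, so
at most one index matters. For a pair the first identifier suffices: if the two are adjacent they
share the index, and otherwise the answer is always negative. -/
theorem answer_cliqueMatchingInput_congr {I I' : Finset ℕ} {q : Query} (hv : q ≠ .randVert)
    (he : q ≠ .randEdge) (hq : ∀ i, touchedIndex h q = some i → (i ∈ I ↔ i ∈ I')) :
    (cliqueMatchingInput hh I).answer q = (cliqueMatchingInput hh I').answer q := by
  have hG := inducedFrom_cliqueMatchingInput hh I
  have hG' := inducedFrom_cliqueMatchingInput hh I'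
  have near : ∀ x, (∀ i, (if h ≤ x then some ((x - h) / 2) else none) = some i →
      (i ∈ I ↔ i ∈ I')) → ∀ y, (y = x ∨ (cliqueMatching h).Adj x y) →
      (y ∈ (cliqueMatchingInput hh I).idFinset ↔ y ∈ (cliqueMatchingInput hh I').idFinset) := by
    intro x hx y hy
    rw [idFinset_cliqueMatchingInput, idFinset_cliqueMatchingInput, mem_cliqueMatchingIds,
      mem_cliqueMatchingIds]
    rcases lt_or_ge x h with hlt | hge
    · have : y < h := by
        rcases hy with rfl | hy
        · exact hlt
        · rw [cliqueMatching_adj] at hy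
          omega
      simp [this]
    · have h1 := hx _ (if_pos hge)
      have h2 : (y - h) / 2 = (x - h) / 2 := by
        rcases hy with rfl | hy
        · rfl
        · rw [cliqueMatching_adj] at hy
          omega
      rw [h2, h1]
  cases q with
  | randVert => exact absurd rfl hv
  | randEdge => exact absurd rfl he
  | randNbr x => exact (hG.answer_congr hG' (near x hq)).1
  | degree x => exact (hG.answer_congr hG' (near x hq)).2.1
  | fullNbrHood x => exact (hG.answer_congr hG' (near x hq)).2.2
  | pair x y =>
    refine (hG.answer_pair x y).trans (Eq.trans ?_ (hG'.answer_pair x y).symm)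
    congr 2
    rw [eq_iff_iff]
    by_cases hxy : (cliqueMatching h).Adj x y
    · rw [near x hq x (Or.inl rfl), near x hq y (Or.inr hxy)]
    · simp [hxy]

end CliqueWithMatching

/-! ### Counting index sets compatible with partial knowledge -/

section IndexSets

/-- Two sets of indices of matching edges: those known to be present and those known to be
absent. -/
abbrev Knowledge : Type := Finset ℕ × Finset ℕ

/-- The indices below `M` about which nothing is known. -/
def Knowledge.unknown (M : ℕ) (c : Knowledge) : Finset ℕ := Finset.range M \ (c.1 ∪ c.2)

/-- The knowledge is about indices below `M` and not contradictory. -/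
structure Knowledge.Valid (M : ℕ) (c : Knowledge) : Prop where
  present_subset : c.1 ⊆ Finset.range M
  absent_subset : c.2 ⊆ Finset.range M
  disjoint : Disjoint c.1 c.2

/-- The sets of `L` indices below `M` that agree with the given knowledge. -/
def indexSets (M L : ℕ) (c : Knowledge) : Finset (Finset ℕ) :=
  (Finset.powersetCard L (Finset.range M)).filter fun I => c.1 ⊆ I ∧ Disjoint I c.2

variable {M L : ℕ} {c : Knowledge}

theorem mem_indexSets {I : Finset ℕ} : I ∈ indexSets M L c ↔
    (I ⊆ Finset.range M ∧ I.card = L) ∧ c.1 ⊆ I ∧ Disjoint I c.2 := by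
  rw [indexSets, Finset.mem_filter, Finset.mem_powersetCard]

theorem Knowledge.Valid.card_unknown (hc : c.Valid M) :
    (c.unknown M).card = M - (c.1.card + c.2.card) := by
  rw [Knowledge.unknown, Finset.card_sdiff_of_subset
    (Finset.union_subset hc.present_subset hc.absent_subset), Finset.card_range,
    Finset.card_union_of_disjoint hc.disjoint]

theorem Knowledge.Valid.insert_present (hc : c.Valid M) {i : ℕ} (hi : i ∈ c.unknown M) :
    Knowledge.Valid M (insert i c.1, c.2) := by
  simp only [Knowledge.unknown, Finset.mem_sdiff, Finset.mem_union, not_or] at hi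
  exact ⟨Finset.insert_subset hi.1 hc.present_subset, hc.absent_subset,
    Finset.disjoint_insert_left.2 ⟨hi.2.2, hc.disjoint⟩⟩

theorem Knowledge.Valid.insert_absent (hc : c.Valid M) {i : ℕ} (hi : i ∈ c.unknown M) :
    Knowledge.Valid M (c.1, insert i c.2) := by
  simp only [Knowledge.unknown, Finset.mem_sdiff, Finset.mem_union, not_or] at hi
  exact ⟨hc.present_subset, Finset.insert_subset hi.1 hc.absent_subset,
    Finset.disjoint_insert_right.2 ⟨hi.2.1, hc.disjoint⟩⟩

/-- Removing the known part leaves an arbitrary set of `L - c.1.card` unknown indices. -/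
theorem Knowledge.Valid.card_indexSets (hc : c.Valid M) (hL : c.1.card ≤ L) :
    (indexSets M L c).card = (M - (c.1.card + c.2.card)).choose (L - c.1.card) := by
  rw [← hc.card_unknown, ← Finset.card_powersetCard]
  refine Finset.card_bij' (fun I _ => I \ c.1) (fun J _ => J ∪ c.1) ?_ ?_ ?_ ?_
  · intro I hI
    obtain ⟨⟨h1, h2⟩, h3, h4⟩ := mem_indexSets.1 hI
    rw [Finset.mem_powersetCard, Finset.card_sdiff_of_subset h3, h2]
    refine ⟨fun i hi => ?_, rfl⟩
    rw [Finset.mem_sdiff] at hi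
    simp only [Knowledge.unknown, Finset.mem_sdiff, Finset.mem_union, not_or]
    exact ⟨h1 hi.1, hi.2, Finset.disjoint_left.1 h4 hi.1⟩
  · intro J hJ
    obtain ⟨h1, h2⟩ := Finset.mem_powersetCard.1 hJ
    have h3 : ∀ i ∈ J, i ∈ Finset.range M ∧ i ∉ c.1 ∧ i ∉ c.2 := fun i hi => by
      simpa only [Knowledge.unknown, Finset.mem_sdiff, Finset.mem_union, not_or] using h1 hi
    rw [mem_indexSets, Finset.card_union_of_disjoint
      (Finset.disjoint_left.2 fun i hi => (h3 i hi).2.1), h2]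
    exact ⟨⟨Finset.union_subset (fun i hi => (h3 i hi).1) hc.present_subset, by omega⟩,
      Finset.subset_union_right,
      Finset.disjoint_union_left.2 ⟨Finset.disjoint_left.2 fun i hi => (h3 i hi).2.2,
        hc.disjoint⟩⟩
  · intro I hI
    exact Finset.sdiff_union_of_subset (mem_indexSets.1 hI).2.1
  · intro J hJ
    obtain ⟨h1, -⟩ := Finset.mem_powersetCard.1 hJ
    refine Finset.union_sdiff_cancel_right (Finset.disjoint_left.2 fun i hi => ?_)
    have := h1 hi
    simp only [Knowledge.unknown, Finset.mem_sdiff, Finset.mem_union, not_or] at this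
    exact this.2.1

/-- With `U` unknown indices, a given one is present with conditional probability `(L - c.1.card) /
U`, here without division. -/
theorem Knowledge.Valid.card_indexSets_insert_present (hc : c.Valid M) (hL : c.1.card < L)
    {i : ℕ} (hi : i ∈ c.unknown M) :
    (c.unknown M).card * (indexSets M L (insert i c.1, c.2)).card =
      (L - c.1.card) * (indexSets M L c).card := by
  have hi' := hi
  simp only [Knowledge.unknown, Finset.mem_sdiff, Finset.mem_union, not_or] at hi'
  have hcard : (insert i c.1).card = c.1.card + 1 := Finset.card_insert_of_notMem hi'.2.1
  have hpos : 0 < M - (c.1.card + c.2.card) := by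
    rw [← hc.card_unknown]; exact Finset.card_pos.2 ⟨i, hi⟩
  rw [(hc.insert_present hi).card_indexSets (by dsimp only; omega), hc.card_indexSets hL.le,
    hc.card_unknown]
  dsimp only
  rw [hcard]
  obtain ⟨N, hN⟩ := Nat.exists_eq_succ_of_ne_zero hpos.ne'
  obtain ⟨l, hl⟩ := Nat.exists_eq_succ_of_ne_zero (Nat.sub_pos_of_lt hL).ne'
  rw [hN, hl, show M - (c.1.card + 1 + c.2.card) = N by omega,
    show L - (c.1.card + 1) = l by omega, Nat.succ_eq_add_one, Nat.succ_eq_add_one,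
    Nat.add_one_mul_choose_eq, mul_comm]

/-- The complementary conditional probability, in the same division-free form. -/
theorem Knowledge.Valid.card_indexSets_insert_absent (hc : c.Valid M) (hL : c.1.card ≤ L)
    {i : ℕ} (hi : i ∈ c.unknown M) :
    (c.unknown M).card * (indexSets M L (c.1, insert i c.2)).card =
      ((c.unknown M).card - (L - c.1.card)) * (indexSets M L c).card := by
  have hi' := hi
  simp only [Knowledge.unknown, Finset.mem_sdiff, Finset.mem_union, not_or] at hi'
  have hcard : (insert i c.2).card = c.2.card + 1 := Finset.card_insert_of_notMem hi'.2.2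
  have hpos : 0 < M - (c.1.card + c.2.card) := by
    rw [← hc.card_unknown]; exact Finset.card_pos.2 ⟨i, hi⟩
  rw [(hc.insert_absent hi).card_indexSets hL, hc.card_indexSets hL, hc.card_unknown]
  dsimp only
  rw [hcard]
  obtain ⟨N, hN⟩ := Nat.exists_eq_succ_of_ne_zero hpos.ne'
  rw [hN, show M - (c.1.card + (c.2.card + 1)) = N by omega, Nat.succ_eq_add_one, mul_comm,
    Nat.choose_mul_succ_eq, mul_comm]

end IndexSets

end

/-! ### The lazy oracle and its comparison with true answers -/

noncomputable section

section LazyOracle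

variable {h : ℕ} (hh : 2 ≤ h) (M : ℕ)

/-- The edges of the clique. -/
def cliqueEdges (h : ℕ) : Finset (Sym2 ℕ) := (Finset.range h).offDiag.image Sym2.mk.uncurry

theorem card_cliqueEdges (h : ℕ) : (cliqueEdges h).card = h.choose 2 := by
  rw [cliqueEdges, Sym2.card_image_offDiag, Finset.card_range]

theorem cliqueEdges_nonempty (hh : 2 ≤ h) : (cliqueEdges h).Nonempty := by
  rw [← Finset.card_pos, card_cliqueEdges]
  exact Nat.choose_pos hh

/-- The knowledge after a query about the index `i` that is only answered for known indices. -/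
def Knowledge.afterMiss (c : Knowledge) : Option ℕ → Knowledge
  | none => c
  | some i => if i ∈ c.unknown M then (c.1, insert i c.2) else c

open Classical in
/-- Answers that do not depend on the number of matching edges, together with the new knowledge:
random vertices are new matching vertices, random edges are clique edges, and unknown matching
edges are assumed to be absent when they are queried. -/
def lazyAnswer (c : Knowledge) : (q : Query) → PMF (q.Response × Knowledge)
  | .randVert =>
      if hN : (c.unknown M ×ˢ Finset.range 2).Nonempty then
        (PMF.uniformOfFinset _ hN).map
          fun p => ((h + 2 * p.1 + p.2 : ℕ), ((insert p.1 c.1, c.2) : Knowledge))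
      else PMF.pure ((0 : ℕ), c)
  | .randEdge => (PMF.uniformOfFinset _ (cliqueEdges_nonempty hh)).map
      fun e => ((e : Sym2 ℕ), c)
  | q => ((cliqueMatchingInput hh c.1).answer q).map
      fun r => (r, c.afterMiss M (touchedIndex h q))

theorem lazyAnswer_eq_map {c : Knowledge} {q : Query} (hv : q ≠ .randVert)
    (he : q ≠ .randEdge) : lazyAnswer hh M c q = ((cliqueMatchingInput hh c.1).answer q).map
      fun r => (r, c.afterMiss M (touchedIndex h q)) := by
  cases q <;> first | rfl | exact absurd rfl hv | exact absurd rfl he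

/-- Run `A` with the answers of `lazyAnswer`. -/
def lazyRun (A : QueryAlgorithm) : ℕ → A.State → Knowledge → PMF (Option ℝ)
  | 0, s, _ =>
      match A.next s with
      | .inr x => PMF.pure (some x)
      | .inl _ => PMF.pure none
  | k + 1, s, c =>
      match A.next s with
      | .inr x => PMF.pure (some x)
      | .inl ⟨q, f⟩ => (lazyAnswer hh M c q).bind fun rc => (f rc.1).bind fun s' =>
          lazyRun A k s' rc.2

/-- With at most `K` queries, the answers of an input with a clique on `h` vertices and a random set
of `L` out of `M` possible matching edges are those of `lazyAnswer`, except with probability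
`1 - ρ` for each query. -/
structure LazyBound (h M L K : ℕ) (ρ : ℝ≥0∞) : Prop where
  le_one : ρ ≤ 1
  K_le : K ≤ L
  K_lt : K < M
  vertex : ρ * ((h + 2 * L : ℕ) : ℝ≥0∞) ≤ ((2 * (L - K) : ℕ) : ℝ≥0∞)
  edge : ρ * ((h.choose 2 + L : ℕ) : ℝ≥0∞) ≤ (h.choose 2 : ℕ)
  absent : ∀ N : ℕ, M ≤ N + K → ρ * (N : ℝ≥0∞) ≤ ((N - L : ℕ) : ℝ≥0∞)

theorem PMF.mul_toOuterMeasure_bind_le_sum {α β ι : Type*} (p : PMF α) (s : Finset ι) {a : ℝ≥0∞}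
    {f : α → PMF β} {g : ι → α → PMF β} {X : Set β}
    (H : ∀ r, a * (f r).toOuterMeasure X ≤ ∑ i ∈ s, (g i r).toOuterMeasure X) :
    a * (p.bind f).toOuterMeasure X ≤ ∑ i ∈ s, (p.bind (g i)).toOuterMeasure X := by
  simp only [PMF.toOuterMeasure_bind_apply]
  rw [← ENNReal.tsum_mul_left, ← Summable.tsum_finsetSum fun _ _ => ENNReal.summable]
  refine ENNReal.tsum_le_tsum fun r => ?_
  rw [← Finset.mul_sum, mul_left_comm]
  exact mul_le_mul_right (H r) _

variable {M} {L K : ℕ} {ρ : ℝ≥0∞} {c : Knowledge} {β : Type*} {X : Set β} {t : ℝ≥0∞}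

/-- For a random `I`, the sampled vertex is a new matching vertex with probability `2 (L - c.1.card)
/ (h + 2 L) ≥ ρ`. Given that, its index is uniform among the unknown ones, and `I` is uniform among
the sets compatible with the enlarged knowledge. -/
theorem lazyAnswer_randVert_le (hρ : LazyBound h M L K ρ) (hc : c.Valid M)
    (hK : c.1.card + c.2.card < K) {F : Finset ℕ → ℕ → PMF β} {Ψ : ℕ → Knowledge → PMF β}
    (H : ∀ r, ∀ c' : Knowledge, c'.Valid M → c'.1.card + c'.2.card ≤ c.1.card + c.2.card + 1 →
      t * (indexSets M L c').card * (Ψ r c').toOuterMeasure X ≤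
        ∑ I ∈ indexSets M L c', (F I r).toOuterMeasure X) :
    ρ * t * (indexSets M L c).card *
        ((lazyAnswer hh M c .randVert).bind fun rc => Ψ rc.1 rc.2).toOuterMeasure X ≤
      ∑ I ∈ indexSets M L c,
        (((cliqueMatchingInput hh I).answer .randVert).bind (F I)).toOuterMeasure X := by
  have hU := hc.card_unknown
  have hUpos : 0 < (c.unknown M).card := by have := hρ.K_lt; omega
  have hN : (c.unknown M ×ˢ Finset.range 2).Nonempty :=
    (Finset.card_pos.1 hUpos).product ⟨0, by simp⟩
  have hlazy : (lazyAnswer hh M c .randVert).bind (fun rc => Ψ rc.1 rc.2) =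
      (PMF.uniformOfFinset _ hN).bind fun p =>
        Ψ (h + 2 * p.1 + p.2) (insert p.1 c.1, c.2) := by
    change PMF.bind (dite _ _ _) _ = _
    rw [dif_pos hN, PMF.bind_map]
    rfl
  rw [hlazy, PMF.toOuterMeasure_uniformOfFinset_bind, Finset.sum_product, Finset.card_product,
    Finset.card_range]
  simp only [Finset.sum_range_succ, Finset.range_zero, Finset.sum_empty, zero_add, add_zero]
  have hstep : ∀ I ∈ indexSets M L c,
      (∑ i ∈ I \ c.1, ((F I (h + 2 * i)).toOuterMeasure X +
        (F I (h + 2 * i + 1)).toOuterMeasure X)) / ((h + 2 * L : ℕ) : ℝ≥0∞) ≤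
      (((cliqueMatchingInput hh I).answer .randVert).bind (F I)).toOuterMeasure X := by
    intro I hI
    rw [InputGraph.toOuterMeasure_answer_randVert_bind, idFinset_cliqueMatchingInput,
      n_cliqueMatchingInput, (mem_indexSets.1 hI).1.2, sum_cliqueMatchingIds]
    gcongr
    -- Clique vertices and already known indices are dropped, since only a lower bound is needed.
    refine le_add_of_nonneg_of_le zero_le ?_
    exact Finset.sum_le_sum_of_subset Finset.sdiff_subset
  refine le_trans ?_ (Finset.sum_le_sum hstep)
  simp only [div_eq_mul_inv]
  rw [← Finset.sum_mul, ← div_eq_mul_inv, ← div_eq_mul_inv]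
  -- Exchanges the order of revelation: choosing `I` and then a new index in it equals choosing an
  -- unknown index and then a compatible set containing it.
  have hswap : ∑ I ∈ indexSets M L c, ∑ i ∈ I \ c.1, ((F I (h + 2 * i)).toOuterMeasure X +
        (F I (h + 2 * i + 1)).toOuterMeasure X) =
      ∑ i ∈ c.unknown M, ∑ I ∈ indexSets M L (insert i c.1, c.2),
        ((F I (h + 2 * i)).toOuterMeasure X + (F I (h + 2 * i + 1)).toOuterMeasure X) := by
    refine Finset.sum_comm' fun I i => ?_
    simp only [mem_indexSets, Finset.mem_sdiff, Knowledge.unknown, Finset.mem_union,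
      Finset.insert_subset_iff, not_or]
    constructor
    · rintro ⟨⟨⟨h1, h2⟩, h3, h4⟩, h5, h6⟩
      exact ⟨⟨⟨h1, h2⟩, ⟨h5, h3⟩, h4⟩, h1 h5, h6, Finset.disjoint_left.1 h4 h5⟩
    · rintro ⟨⟨⟨h1, h2⟩, ⟨h5, h3⟩, h4⟩, -, h6, -⟩
      exact ⟨⟨⟨h1, h2⟩, h3, h4⟩, h5, h6⟩
  rw [hswap]
  have hcardlt : c.1.card < L := by have := hρ.K_le; omega
  set U := (c.unknown M).card
  set S := ∑ i ∈ c.unknown M, ((Ψ (h + 2 * i) (insert i c.1, c.2)).toOuterMeasure X +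
    (Ψ (h + 2 * i + 1) (insert i c.1, c.2)).toOuterMeasure X) with hS
  have hU0 : (U : ℝ≥0∞) ≠ 0 := by exact_mod_cast hUpos.ne'
  have hlow : t * (((L - c.1.card) * (indexSets M L c).card : ℕ) : ℝ≥0∞) / U * S ≤
      ∑ i ∈ c.unknown M, ∑ I ∈ indexSets M L (insert i c.1, c.2),
        ((F I (h + 2 * i)).toOuterMeasure X + (F I (h + 2 * i + 1)).toOuterMeasure X) := by
    rw [hS, Finset.mul_sum]
    refine Finset.sum_le_sum fun i hi => ?_
    rw [← hc.card_indexSets_insert_present hcardlt hi, Nat.cast_mul, ← mul_assoc, mul_comm t,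
      mul_assoc, mul_comm (U : ℝ≥0∞), ENNReal.mul_div_cancel_right hU0 (by simp), mul_add,
      Finset.sum_add_distrib]
    have hcard : (insert i c.1).card + c.2.card ≤ c.1.card + c.2.card + 1 := by
      have := Finset.card_insert_le i c.1
      omega
    exact add_le_add (H _ _ (hc.insert_present hi) hcard) (H _ _ (hc.insert_present hi) hcard)
  refine le_trans ?_ (ENNReal.div_le_div_right hlow _)
  have hratio : ρ * ((h + 2 * L : ℕ) : ℝ≥0∞) ≤ ((2 * (L - c.1.card) : ℕ) : ℝ≥0∞) :=
    hρ.vertex.trans (by exact_mod_cast (by omega : 2 * (L - K) ≤ 2 * (L - c.1.card)))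
  have hn0 : ((h + 2 * L : ℕ) : ℝ≥0∞) ≠ 0 := by
    have : h + 2 * L ≠ 0 := by omega
    exact_mod_cast this
  rw [ENNReal.le_div_iff_mul_le (Or.inl hn0) (Or.inl (ENNReal.natCast_ne_top _))]
  have e2 : (2 : ℝ≥0∞)⁻¹ * 2 = 1 := ENNReal.inv_mul_cancel (by simp) (by simp)
  calc ρ * t * (indexSets M L c).card * (S / ((U * 2 : ℕ) : ℝ≥0∞)) * ((h + 2 * L : ℕ) : ℝ≥0∞)
      = t * (indexSets M L c).card * (S / ((U * 2 : ℕ) : ℝ≥0∞)) *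
          (ρ * ((h + 2 * L : ℕ) : ℝ≥0∞)) := by ring
    _ ≤ t * (indexSets M L c).card * (S / ((U * 2 : ℕ) : ℝ≥0∞)) *
        ((2 * (L - c.1.card) : ℕ) : ℝ≥0∞) := mul_le_mul_right hratio _
    _ = (2 : ℝ≥0∞)⁻¹ * 2 * (t * (indexSets M L c).card * S * (U : ℝ≥0∞)⁻¹ *
          ((L - c.1.card : ℕ) : ℝ≥0∞)) := by
        rw [Nat.cast_mul, Nat.cast_mul, div_eq_mul_inv,
          ENNReal.mul_inv (Or.inl hU0) (Or.inl (by simp)), Nat.cast_ofNat]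
        ring
    _ = _ := by
        rw [e2, Nat.cast_mul, div_eq_mul_inv]
        ring

/-- Every instance contains the clique edges, which make up at least a fraction `ρ` of its edges.
They say nothing about `I`, so the knowledge stays the same. -/
theorem lazyAnswer_randEdge_le (hρ : LazyBound h M L K ρ) (hc : c.Valid M)
    {F : Finset ℕ → Sym2 ℕ → PMF β} {Ψ : Sym2 ℕ → Knowledge → PMF β}
    (H : ∀ r, ∀ c' : Knowledge, c'.Valid M → c'.1.card + c'.2.card ≤ c.1.card + c.2.card + 1 →
      t * (indexSets M L c').card * (Ψ r c').toOuterMeasure X ≤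
        ∑ I ∈ indexSets M L c', (F I r).toOuterMeasure X) :
    ρ * t * (indexSets M L c).card *
        ((lazyAnswer hh M c .randEdge).bind fun rc => Ψ rc.1 rc.2).toOuterMeasure X ≤
      ∑ I ∈ indexSets M L c,
        (((cliqueMatchingInput hh I).answer .randEdge).bind (F I)).toOuterMeasure X := by
  classical
  have hlazy : (lazyAnswer hh M c .randEdge).bind (fun rc => Ψ rc.1 rc.2) =
      (PMF.uniformOfFinset _ (cliqueEdges_nonempty hh)).bind fun e => Ψ e c := by
    change PMF.bind (PMF.map _ _) _ = _
    rw [PMF.bind_map]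
    rfl
  rw [hlazy, PMF.toOuterMeasure_uniformOfFinset_bind, card_cliqueEdges]
  set m : ℝ≥0∞ := ((h.choose 2 + L : ℕ) : ℝ≥0∞) with hm
  have hstep : ∀ I ∈ indexSets M L c,
      (∑ e ∈ cliqueEdges h, (F I e).toOuterMeasure X) / m ≤
      (((cliqueMatchingInput hh I).answer .randEdge).bind (F I)).toOuterMeasure X := by
    intro I hI
    have hcard : (cliqueMatchingInput hh I).graph.edgeFinset.card = h.choose 2 + L := by
      have h1 := two_mul_card_edgeFinset_cliqueMatchingInput hh I
      rw [(mem_indexSets.1 hI).1.2] at h1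
      have h2 : h.choose 2 * 2 = h * (h - 1) := by
        rw [Nat.choose_two_right, Nat.div_mul_cancel (Nat.even_mul_pred_self h).two_dvd]
      omega
    rw [InputGraph.toOuterMeasure_answer_randEdge_bind, hcard]
    gcongr
    rw [← Finset.sum_image (f := fun e => (F I e).toOuterMeasure X)
      (fun e _ e' _ he => Sym2.map.injective (cliqueMatchingInput hh I).id.injective he)]
    refine Finset.sum_le_sum_of_subset fun e he => ?_
    obtain ⟨⟨a, b⟩, hab, rfl⟩ := Finset.mem_image.1 he
    rw [Finset.mem_offDiag, Finset.mem_range, Finset.mem_range] at hab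
    have hmem : ∀ a < h, ∃ u, (cliqueMatchingInput hh I).id u = a := fun a ha => by
      rw [← InputGraph.mem_idFinset, idFinset_cliqueMatchingInput]
      exact mem_cliqueMatchingIds.2 (Or.inl ha)
    obtain ⟨u, rfl⟩ := hmem a hab.1
    obtain ⟨v, rfl⟩ := hmem b hab.2.1
    refine Finset.mem_image.2 ⟨s(u, v), ?_, rfl⟩
    rw [SimpleGraph.mem_edgeFinset, SimpleGraph.mem_edgeSet, inducedFrom_cliqueMatchingInput hh I,
      cliqueMatching_adj]
    exact ⟨hab.2.2, Or.inl ⟨hab.1, hab.2.1⟩⟩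
  refine le_trans ?_ (Finset.sum_le_sum hstep)
  simp only [div_eq_mul_inv]
  rw [← Finset.sum_mul, Finset.sum_comm, ← div_eq_mul_inv]
  have hQ : (h.choose 2 : ℝ≥0∞) ≠ 0 := by exact_mod_cast (Nat.choose_pos hh).ne'
  have hm0 : m ≠ 0 := by
    rw [hm]
    exact_mod_cast (Nat.add_pos_left (Nat.choose_pos hh) L).ne'
  have hlow : t * (indexSets M L c).card * ∑ e ∈ cliqueEdges h, (Ψ e c).toOuterMeasure X ≤
      ∑ e ∈ cliqueEdges h, ∑ I ∈ indexSets M L c, (F I e).toOuterMeasure X := by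
    rw [Finset.mul_sum]
    exact Finset.sum_le_sum fun e _ => H e c hc (by omega)
  refine le_trans ?_ (ENNReal.div_le_div_right hlow _)
  rw [ENNReal.le_div_iff_mul_le (Or.inl hm0) (Or.inl (ENNReal.natCast_ne_top _))]
  set S := ∑ e ∈ cliqueEdges h, (Ψ e c).toOuterMeasure X
  calc ρ * t * (indexSets M L c).card * (S * (h.choose 2 : ℝ≥0∞)⁻¹) * m
      = t * (indexSets M L c).card * (S * (h.choose 2 : ℝ≥0∞)⁻¹) * (ρ * m) := by ring
    _ ≤ t * (indexSets M L c).card * (S * (h.choose 2 : ℝ≥0∞)⁻¹) * (h.choose 2 : ℕ) :=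
        mul_le_mul_right hρ.edge _
    _ = (h.choose 2 : ℝ≥0∞)⁻¹ * (h.choose 2 : ℝ≥0∞) * (t * (indexSets M L c).card * S) := by ring
    _ = _ := by rw [ENNReal.inv_mul_cancel hQ (ENNReal.natCast_ne_top _), one_mul]

/-- For the other queries at most one index matters. Discarding the sets `I` that contain it while
it is unknown costs a factor `ρ` in their number, and the remaining sets all answer as `c.1` alone
does. -/
theorem lazyAnswer_le (hρ : LazyBound h M L K ρ) (hc : c.Valid M)
    (hK : c.1.card + c.2.card < K) {q : Query} {F : Finset ℕ → q.Response → PMF β}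
    {Ψ : q.Response → Knowledge → PMF β}
    (H : ∀ r, ∀ c' : Knowledge, c'.Valid M → c'.1.card + c'.2.card ≤ c.1.card + c.2.card + 1 →
      t * (indexSets M L c').card * (Ψ r c').toOuterMeasure X ≤
        ∑ I ∈ indexSets M L c', (F I r).toOuterMeasure X) :
    ρ * t * (indexSets M L c).card *
        ((lazyAnswer hh M c q).bind fun rc => Ψ rc.1 rc.2).toOuterMeasure X ≤
      ∑ I ∈ indexSets M L c,
        (((cliqueMatchingInput hh I).answer q).bind (F I)).toOuterMeasure X := by
  by_cases hv : q = .randVert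
  · subst hv
    exact lazyAnswer_randVert_le hh hρ hc hK H
  by_cases he : q = .randEdge
  · subst he
    exact lazyAnswer_randEdge_le hh hρ hc H
  have hlazy : (lazyAnswer hh M c q).bind (fun rc => Ψ rc.1 rc.2) =
      ((cliqueMatchingInput hh c.1).answer q).bind fun r =>
        Ψ r (c.afterMiss M (touchedIndex h q)) := by
    rw [lazyAnswer_eq_map hh M hv he, PMF.bind_map]
    rfl
  rw [hlazy]
  set c' := c.afterMiss M (touchedIndex h q) with hc'
  -- A newly touched index lies in neither `I` nor `c.1`. A known one lies in both or in neither.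
  have hanswer : ∀ I ∈ indexSets M L c', I ∈ indexSets M L c →
      (cliqueMatchingInput hh I).answer q = (cliqueMatchingInput hh c.1).answer q := by
    intro I hI' hI
    refine answer_cliqueMatchingInput_congr hh hv he fun i hi => ?_
    obtain ⟨⟨h1, -⟩, h3, h4⟩ := mem_indexSets.1 hI
    rw [hi] at hc'
    by_cases hu : i ∈ c.unknown M
    · have h5 := (mem_indexSets.1 hI').2.2
      rw [hc', Knowledge.afterMiss, if_pos hu] at h5
      have h6 : i ∉ I := fun h => Finset.disjoint_left.1 h5 h (Finset.mem_insert_self _ _)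
      exact ⟨fun h => absurd h h6, fun h => h3 h⟩
    · refine ⟨fun h => ?_, fun h => h3 h⟩
      simp only [Knowledge.unknown, Finset.mem_sdiff, Finset.mem_union, not_and, not_not] at hu
      exact (hu (h1 h)).resolve_right (Finset.disjoint_left.1 h4 h)
  have hsub : indexSets M L c' ⊆ indexSets M L c := by
    intro I hI
    cases hq : touchedIndex h q with
    | none => rw [hc', hq] at hI; exact hI
    | some i =>
      rw [hc', hq, Knowledge.afterMiss] at hI
      split_ifs at hI
      · obtain ⟨h1, h2, h3⟩ := mem_indexSets.1 hI
        exact mem_indexSets.2 ⟨h1, h2, (Finset.disjoint_insert_right.1 h3).2⟩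
      · exact hI
  have hcard : c'.Valid M ∧ c'.1.card + c'.2.card ≤ c.1.card + c.2.card + 1 ∧
      ρ * (indexSets M L c).card ≤ (indexSets M L c').card := by
    have same : c.Valid M ∧ c.1.card + c.2.card ≤ c.1.card + c.2.card + 1 ∧
      ρ * (indexSets M L c).card ≤ (indexSets M L c).card :=
      ⟨hc, by omega, mul_le_of_le_one_left zero_le hρ.le_one⟩
    cases hq : touchedIndex h q with
    | none => rw [hc', hq]; exact same
    | some i =>
      rw [hc', hq, Knowledge.afterMiss]
      split_ifs with hu
      · refine ⟨hc.insert_absent hu, ?_, ?_⟩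
        · have := Finset.card_insert_le i c.2
          dsimp only
          omega
        · have hKL := hρ.K_le
          have h1 := hc.card_indexSets_insert_absent (L := L) (by omega) hu
          have hUpos : 0 < (c.unknown M).card := Finset.card_pos.2 ⟨i, hu⟩
          have hU := hc.card_unknown
          set U := (c.unknown M).card
          have h2 := hρ.absent U (by omega)
          have hU0 : (U : ℝ≥0∞) ≠ 0 := by exact_mod_cast hUpos.ne'
          refine (ENNReal.mul_le_mul_iff_right hU0 (ENNReal.natCast_ne_top _)).1 ?_
          rw [← Nat.cast_mul, h1, Nat.cast_mul, ← mul_assoc, mul_comm (U : ℝ≥0∞)]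
          gcongr
          exact h2.trans (by exact_mod_cast (by omega : U - L ≤ U - (L - c.1.card)))
      · exact same
  obtain ⟨v', s', r'⟩ := hcard
  refine le_trans ?_ (Finset.sum_le_sum_of_subset hsub)
  rw [Finset.sum_congr rfl fun I hI => by rw [hanswer I hI (hsub hI)]]
  refine PMF.mul_toOuterMeasure_bind_le_sum _ _ fun r => le_trans ?_ (H r c' v' s')
  gcongr ?_ * _
  calc ρ * t * (indexSets M L c).card = t * (ρ * (indexSets M L c).card) := by ring
    _ ≤ _ := by gcongr

/-- Induction over queries, losing a factor `ρ` each time. Summing over compatible `I` keeps the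
invariant that, given the knowledge, the hidden set is uniform. The lazy law does not involve `L`,
so one such law serves both instances. -/
theorem lazyRun_le (hρ : LazyBound h M L K ρ) (A : QueryAlgorithm) (k : ℕ) (s : A.State)
    {c : Knowledge} (hc : c.Valid M) (hK : c.1.card + c.2.card + k ≤ K) (X : Set (Option ℝ)) :
    ρ ^ k * (indexSets M L c).card * (lazyRun hh M A k s c).toOuterMeasure X ≤
      ∑ I ∈ indexSets M L c, (A.runFrom (cliqueMatchingInput hh I) k s).toOuterMeasure X := by
  have stopped : ∀ (c : Knowledge) (k : ℕ) (p : PMF (Option ℝ)),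
      ρ ^ k * (indexSets M L c).card * p.toOuterMeasure X ≤
        ∑ I ∈ indexSets M L c, p.toOuterMeasure X := by
    intro c k p
    rw [Finset.sum_const, nsmul_eq_mul, mul_assoc]
    exact mul_le_of_le_one_left zero_le (pow_le_one₀ zero_le hρ.le_one)
  induction k generalizing s c with
  | zero =>
    cases hn : A.next s with
    | inr x => simpa only [lazyRun, QueryAlgorithm.runFrom, hn] using stopped c 0 _
    | inl qf => simpa only [lazyRun, QueryAlgorithm.runFrom, hn] using stopped c 0 _
  | succ k ih =>
    cases hn : A.next s with
    | inr x => simpa only [lazyRun, QueryAlgorithm.runFrom, hn] using stopped c (k + 1) _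
    | inl qf =>
      simp only [lazyRun, QueryAlgorithm.runFrom, hn]
      rw [pow_succ' ρ k]
      refine lazyAnswer_le hh hρ hc (by omega)
        (F := fun I r => (qf.2 r).bind fun s' => A.runFrom (cliqueMatchingInput hh I) k s')
        (Ψ := fun r c' => (qf.2 r).bind fun s' => lazyRun hh M A k s' c') ?_
      intro r c' hc' hs
      refine PMF.mul_toOuterMeasure_bind_le_sum _ _ fun s' => ih s' hc' (by omega)

end LazyOracle

end

/-! ### Choice of parameters and the lower bound -/

noncomputable section

section LowerBound

variable {h : ℕ} (hh : 2 ≤ h) {M L L' K : ℕ} {ρ : ℝ≥0∞}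

/-- The empty knowledge. -/
def Knowledge.empty : Knowledge := (∅, ∅)

theorem Knowledge.valid_empty (M : ℕ) : Knowledge.empty.Valid M :=
  ⟨Finset.empty_subset _, Finset.empty_subset _, Finset.disjoint_empty_left _⟩

theorem card_indexSets_empty_pos (hL : L ≤ M) : 0 < (indexSets M L .empty).card := by
  rw [(Knowledge.valid_empty M).card_indexSets (Nat.zero_le _)]
  exact Nat.choose_pos (by simpa [Knowledge.empty] using hL)

theorem lazyRun_init_le (hρ : LazyBound h M L K ρ) (A : QueryAlgorithm) (X : Set (Option ℝ)) :
    ρ ^ K * (indexSets M L .empty).card *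
        (A.init.bind fun s => lazyRun hh M A K s .empty).toOuterMeasure X ≤
      ∑ I ∈ indexSets M L .empty,
        (A.init.bind (A.runFrom (cliqueMatchingInput hh I) K)).toOuterMeasure X :=
  PMF.mul_toOuterMeasure_bind_le_sum _ _ fun s =>
    lazyRun_le hh hρ A K s (Knowledge.valid_empty M) (by simp [Knowledge.empty]) X

/-- An algorithm that outputs an element of `S` with probability at least `5 / 12` for `L` matching
edges, and at most `1 / 3` for `L'` matching edges, has to see a difference. -/
theorem pow_add_le_of_distinguishes (hρ : LazyBound h M L K ρ) (hρ' : LazyBound h M L' K ρ)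
    (hL : L ≤ M) (hL' : L' ≤ M) (A : QueryAlgorithm) (S : Set ℝ)
    (h0 : ∀ I ∈ indexSets M L .empty, 5 / 12 ≤ A.probWithin (cliqueMatchingInput hh I) K S)
    (h1 : ∀ I ∈ indexSets M L' .empty, A.probWithin (cliqueMatchingInput hh I) K S ≤ 1 / 3) :
    ρ ^ K + 5 / 12 ≤ 1 + 1 / 3 := by
  set p := A.init.bind fun s => lazyRun hh M A K s .empty with hp
  set T : Set (Option ℝ) := some '' S with hT
  -- A run that has not stopped counts in `Tᶜ`, so the lazy law needs no halting guarantee.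
  have b0 : ρ ^ K * p.toOuterMeasure Tᶜ + 5 / 12 ≤ 1 := by
    have hN := card_indexSets_empty_pos hL
    have e1 := lazyRun_init_le hh hρ A Tᶜ
    have e2 : ((indexSets M L .empty).card : ℝ≥0∞) * (5 / 12) ≤
        ∑ I ∈ indexSets M L .empty,
          (A.init.bind (A.runFrom (cliqueMatchingInput hh I) K)).toOuterMeasure T := by
      rw [← nsmul_eq_mul, ← Finset.sum_const]
      exact Finset.sum_le_sum h0
    have e3 := add_le_add e1 e2
    rw [← Finset.sum_add_distrib, Finset.sum_congr rfl fun I _ => by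
      rw [add_comm, PMF.toOuterMeasure_add_compl], Finset.sum_const, nsmul_eq_mul] at e3
    have hN0 : ((indexSets M L .empty).card : ℝ≥0∞) ≠ 0 := by exact_mod_cast hN.ne'
    refine (ENNReal.mul_le_mul_iff_right hN0 (ENNReal.natCast_ne_top _)).1 ?_
    refine le_trans (le_of_eq ?_) e3
    ring
  have b1 : ρ ^ K * p.toOuterMeasure T ≤ 1 / 3 := by
    have hN := card_indexSets_empty_pos hL'
    have e1 := lazyRun_init_le hh hρ' A T
    have e2 : ∑ I ∈ indexSets M L' .empty,
          (A.init.bind (A.runFrom (cliqueMatchingInput hh I) K)).toOuterMeasure T ≤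
          ((indexSets M L' .empty).card : ℝ≥0∞) * (1 / 3) := by
      rw [← nsmul_eq_mul, ← Finset.sum_const]
      exact Finset.sum_le_sum h1
    have hN0 : ((indexSets M L' .empty).card : ℝ≥0∞) ≠ 0 := by exact_mod_cast hN.ne'
    refine (ENNReal.mul_le_mul_iff_right hN0 (ENNReal.natCast_ne_top _)).1 ?_
    refine le_trans (le_of_eq ?_) (e1.trans e2)
    ring
  calc ρ ^ K + 5 / 12 = ρ ^ K * (p.toOuterMeasure T + p.toOuterMeasure Tᶜ) + 5 / 12 := by
        rw [PMF.toOuterMeasure_add_compl, mul_one]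
    _ = ρ ^ K * p.toOuterMeasure Tᶜ + 5 / 12 + ρ ^ K * p.toOuterMeasure T := by ring
    _ ≤ 1 + 1 / 3 := add_le_add b0 b1

theorem LazyBound.of_real {δ : ℝ} (hδ0 : 0 ≤ δ) (hδ1 : δ ≤ 1) (hKL : K ≤ L) (hKM : K < M)
    (hv : (h : ℝ) + 2 * K ≤ δ * (h + 2 * L)) (he : (L : ℝ) ≤ δ * (h.choose 2 + L))
    (ha : (L : ℝ) ≤ δ * (M - K)) : LazyBound h M L K (ENNReal.ofReal (1 - δ)) := by
  have conv : ∀ a b : ℕ, (1 - δ) * (a : ℝ) ≤ b →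
      ENNReal.ofReal (1 - δ) * (a : ℝ≥0∞) ≤ (b : ℝ≥0∞) := by
    intro a b hab
    rw [← ENNReal.ofReal_natCast, ← ENNReal.ofReal_natCast,
      ← ENNReal.ofReal_mul (sub_nonneg.2 hδ1)]
    exact ENNReal.ofReal_le_ofReal hab
  refine ⟨?_, hKL, hKM, conv _ _ ?_, conv _ _ ?_, fun N hN => conv _ _ ?_⟩
  · rw [← ENNReal.ofReal_one]
    exact ENNReal.ofReal_le_ofReal (by linarith)
  · push_cast [hKL]
    linarith
  · push_cast
    linarith
  · have h1 : (M : ℝ) ≤ N + K := by exact_mod_cast hN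
    have h2 : (L : ℝ) ≤ δ * N := ha.trans (mul_le_mul_of_nonneg_left (by linarith) hδ0)
    have h3 : δ * N ≤ N := mul_le_of_le_one_left N.cast_nonneg hδ1
    have h4 : L ≤ N := by exact_mod_cast h2.trans h3
    rw [Nat.cast_sub h4]
    linarith

theorem avgDeg_cliqueMatchingInput (I : Finset ℕ) :
    (cliqueMatchingInput hh I).avgDeg =
      ((h : ℝ) * (h - 1) + 2 * I.card) / (h + 2 * I.card) := by
  classical
  have h1 := two_mul_card_edgeFinset_cliqueMatchingInput hh I
  have h2 : (2 : ℝ) * (cliqueMatchingInput hh I).graph.edgeFinset.card =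
      (h : ℝ) * (h - 1) + 2 * I.card := by
    rw [← Nat.cast_pred (by omega : 0 < h)]
    exact_mod_cast h1
  rw [InputGraph.avgDeg_eq, h2, n_cliqueMatchingInput]
  push_cast
  rfl

theorem lower_bound :
    ∀ c : ℝ, 1 ≤ c → ∃ (κ : ℝ) (n₀ : ℕ), 0 < κ ∧ ∀ A : QueryAlgorithm,
      (∀ G : InputGraph, 2 / 3 < A.prob G {x | G.avgDeg / c ≤ x ∧ x ≤ c * G.avgDeg}) →
      ∀ n : ℕ, n₀ ≤ n → ∃ G : InputGraph, G.n = n ∧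
        A.probWithin G ⌊κ * (n : ℝ) ^ (1 / 3 : ℝ)⌋₊ Set.univ ≤ 3 / 4 := by
  intro c hc
  -- `R ≥ c ^ 2` matches the gap needed for two intervals of approximation factor `c` to be
  -- disjoint.
  obtain ⟨R, hR⟩ : ∃ R : ℕ, c ^ 2 ≤ R := exists_nat_ge _
  have hR1 : (1 : ℝ) ≤ R := (one_le_pow₀ hc).trans hR
  -- The factor `400` yields `K * δ ≤ 32 / 400 < 1 / 12`. The value of `n₀` gives `r ≥ 64 * R`,
  -- hence `δ ≤ 1 / 2` and control of lower-order terms.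
  refine ⟨1 / (400 * R), (64 * R) ^ 3, by positivity, fun A hA n hn => ?_⟩
  by_contra! hslow
  set r : ℝ := (n : ℝ) ^ (1 / 3 : ℝ) with hr
  have hr3 : r ^ 3 = n := by
    rw [hr, ← Real.rpow_natCast, ← Real.rpow_mul n.cast_nonneg]
    norm_num
  have hr0 : 0 ≤ r := by positivity
  have hrR : 64 * (R : ℝ) ≤ r := by
    refine le_of_pow_le_pow_left₀ (n := 3) (by norm_num) hr0 ?_
    rw [hr3]
    exact_mod_cast hn
  set K := ⌊1 / (400 * (R : ℝ)) * r⌋₊ with hK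
  set a := ⌈r⌉₊ with ha
  have har : r ≤ a := Nat.le_ceil r
  have har' : (a : ℝ) < r + 1 := Nat.ceil_lt_add_one hr0
  have hKr : 400 * R * (K : ℝ) ≤ r := by
    have h1 : (K : ℝ) ≤ 1 / (400 * R) * r := Nat.floor_le (by positivity)
    rw [div_mul_eq_mul_div, one_mul, le_div_iff₀ (by positivity)] at h1
    linarith
  have ha64 : (64 : ℝ) * R ≤ a := hrR.trans har
  have ha64' : (64 : ℝ) ≤ a := by linarith
  have haa : 64 * (a : ℝ) ≤ a ^ 2 := by
    rw [sq]
    exact mul_le_mul_of_nonneg_right ha64' a.cast_nonneg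
  have haaa : 64 * (a : ℝ) ^ 2 ≤ a ^ 3 := by
    rw [pow_succ' _ 2]
    exact mul_le_mul_of_nonneg_right ha64' (by positivity)
  have hna : (n : ℝ) ≤ a ^ 3 := by rw [← hr3]; gcongr
  have han : (a : ℝ) ^ 3 ≤ 8 * n := by
    rw [← hr3, show 8 * r ^ 3 = (2 * r) ^ 3 by ring]
    gcongr
    linarith
  have hn8 : 8 * (a : ℝ) ^ 2 ≤ n := by linarith
  have hKa : (K : ℝ) ≤ a := by nlinarith [K.cast_nonneg (α := ℝ)]
  -- The correction gives `h` the parity of `n`, so that the other vertices can be matched.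
  set h := a ^ 2 + (n + a ^ 2) % 2 with hh_def
  have hha : (a : ℝ) ^ 2 ≤ h := by exact_mod_cast Nat.le_add_right _ _
  have hha' : (h : ℝ) ≤ a ^ 2 + 1 := by
    exact_mod_cast (by omega : h ≤ a ^ 2 + 1)
  have hh : 2 ≤ h := by
    have : (2 : ℝ) ≤ h := by linarith
    exact_mod_cast this
  have hhn : h ≤ n := by
    have : (h : ℝ) ≤ n := by linarith
    exact_mod_cast this
  obtain ⟨L, hL⟩ : ∃ L, h + 2 * L = n := ⟨(n - h) / 2, by omega⟩
  clear_value K a h r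
  have hLr : (h : ℝ) + 2 * L = n := by exact_mod_cast hL
  set L' := R * n with hL'
  have hLr' : (L' : ℝ) = R * n := by rw [hL']; push_cast; rfl
  clear_value L'
  have hn0 : (0 : ℝ) < n := by linarith
  have hnL' : (n : ℝ) ≤ L' := by rw [hLr']; exact le_mul_of_one_le_left hn0.le hR1
  have hLL' : (L : ℝ) ≤ L' := by linarith [h.cast_nonneg (α := ℝ)]
  have hhh : (a : ℝ) ^ 4 / 2 ≤ (h : ℝ) * (h - 1) := by
    have h1 : (a : ℝ) ^ 2 * (a ^ 2 - 1) ≤ (h : ℝ) * (h - 1) := by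
      apply mul_le_mul hha (by linarith) (by nlinarith) (by positivity)
    have h2 : (a : ℝ) ^ 4 = a ^ 2 * a ^ 2 := by ring
    have h3 : 2 * (a : ℝ) ^ 2 ≤ a ^ 2 * a ^ 2 :=
      mul_le_mul_of_nonneg_right (by linarith) (by positivity)
    linarith
  have ha3 : (0 : ℝ) < a ^ 3 := by positivity
  have hRa : 32 * (R * (a : ℝ) ^ 3) ≤ a ^ 4 / 2 := by
    have h1 : 64 * R * (a : ℝ) ^ 3 ≤ a * a ^ 3 := by gcongr
    linarith [pow_succ' (a : ℝ) 3]
  have hRn : R * (n : ℝ) ≤ R * a ^ 3 := by gcongr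
  -- Of order `n ^ (-1/3)`; `32 = 4 * 8` comes from `h + 2 K ≤ 4 a ^ 2` and `a ^ 3 ≤ 8 n` in the
  -- vertex condition.
  set δ : ℝ := 32 * R / a with hδ
  have ha0 : (0 : ℝ) < a := by linarith
  have hδ0 : 0 < δ := by positivity
  have hδ1 : δ ≤ 1 / 2 := by rw [hδ, div_le_iff₀ ha0]; linarith
  -- After `K` queries at least `L' * a` indices remain unknown, so a guessed one is present with
  -- probability at most `1 / a ≤ δ`.
  set M := K + L' * a with hM
  clear_value δ M
  have bound : ∀ l : ℕ, (L : ℝ) ≤ l → (l : ℝ) ≤ L' →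
      LazyBound h M l K (ENNReal.ofReal (1 - δ)) := by
    intro l hl hl'
    refine LazyBound.of_real hδ0.le (by linarith) ?_ ?_ ?_ ?_ ?_
    · have : (K : ℝ) ≤ l := by linarith
      exact_mod_cast this
    · have h1 : (0 : ℝ) < L' * a := mul_pos (by linarith) ha0
      have h2 : 0 < L' * a := by exact_mod_cast h1
      omega
    · have h1 : δ * n ≤ δ * (h + 2 * l) := by gcongr; linarith
      refine le_trans ?_ h1
      rw [hδ, div_mul_eq_mul_div, le_div_iff₀ ha0]
      have h2 : (h : ℝ) + 2 * K ≤ 4 * a ^ 2 := by linarith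
      calc ((h : ℝ) + 2 * K) * a ≤ 4 * a ^ 2 * a := by gcongr
        _ = 4 * a ^ 3 := by ring
        _ ≤ 4 * (8 * n) := by gcongr
        _ ≤ 32 * R * n := by linarith [le_mul_of_one_le_left hn0.le hR1]
    · have h1 : (h.choose 2 : ℝ) = h * (h - 1) / 2 := Nat.cast_choose_two ℝ h
      have h2 : δ * (a ^ 4 / 4) ≤ δ * (h.choose 2 + l) := by
        gcongr
        rw [h1]
        linarith [l.cast_nonneg (α := ℝ)]
      refine le_trans ?_ h2
      rw [hδ, div_mul_eq_mul_div, le_div_iff₀ ha0]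
      calc (l : ℝ) * a ≤ R * a ^ 3 * a := by gcongr; linarith
        _ = R * a ^ 4 := by ring
        _ ≤ 32 * R * (a ^ 4 / 4) := by
            linarith [mul_nonneg (zero_le_one.trans hR1) (pow_pos ha0 4).le]
    · rw [hM]
      push_cast
      rw [hδ, add_sub_cancel_left, div_mul_eq_mul_div, le_div_iff₀ ha0, ← mul_assoc]
      gcongr
      exact hl'.trans (le_mul_of_one_le_left L'.cast_nonneg (by linarith))
  have hL'M : L' ≤ M := by
    have h1 : 1 ≤ a := by exact_mod_cast (by linarith : (1 : ℝ) ≤ a)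
    have := Nat.le_mul_of_pos_right L' h1
    omega
  have hLM : L ≤ M := le_trans (by exact_mod_cast hLL') hL'M
  have key := pow_add_le_of_distinguishes hh (bound L le_rfl hLL') (bound L' hLL' le_rfl) hLM hL'M
    A {x | ((h : ℝ) * (h - 1) + 2 * L) / (h + 2 * L) / c ≤ x ∧
      x ≤ c * (((h : ℝ) * (h - 1) + 2 * L) / (h + 2 * L))} ?_ ?_
  · rw [← ENNReal.ofReal_pow (by linarith)] at key
    have h1 := ENNReal.toReal_mono (by finiteness) key
    rw [ENNReal.toReal_add (by finiteness) (by finiteness),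
      ENNReal.toReal_add (by finiteness) (by finiteness),
      ENNReal.toReal_ofReal (pow_nonneg (by linarith) _)] at h1
    norm_num at h1
    -- Bernoulli's inequality gives `ρ ^ K ≥ 1 - 32 / 400 = 0.92`, contradicting the bound `11 /
    -- 12`.
    have h2 := one_add_mul_le_pow (a := -δ) (by linarith) K
    rw [← sub_eq_add_neg] at h2
    have h3 : K * δ ≤ 32 / 400 := by
      rw [hδ, mul_div_assoc', div_le_div_iff₀ ha0 (by norm_num)]
      linarith
    linarith
  · intro I hI
    have hcard := (mem_indexSets.1 hI).1.2
    have h1 := hA (cliqueMatchingInput hh I)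
    rw [avgDeg_cliqueMatchingInput, hcard] at h1
    have h2 := hslow (cliqueMatchingInput hh I) (by rw [n_cliqueMatchingInput, hcard, hL])
    have h3 := (ENNReal.add_lt_add h1 h2).trans_le (A.prob_add_probWithin_le _ _ K)
    -- Correctness above `2 / 3` and stopping within `K` queries above `3 / 4` overlap with
    -- probability above `5 / 12`.
    have h4 : (2 / 3 : ℝ≥0∞) + 3 / 4 = 1 + 5 / 12 := by
      rw [← ENNReal.toReal_eq_toReal_iff' (by finiteness) (by finiteness),
        ENNReal.toReal_add (by finiteness) (by finiteness),
        ENNReal.toReal_add (by finiteness) (by finiteness)]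
      norm_num
    rw [h4] at h3
    exact (ENNReal.add_le_add_iff_left ENNReal.one_ne_top).1 h3.le
  · intro I hI
    have hcard := (mem_indexSets.1 hI).1.2
    have h1 := hA (cliqueMatchingInput hh I)
    rw [avgDeg_cliqueMatchingInput, hcard] at h1
    have hdisj := A.probWithin_add_prob_le (cliqueMatchingInput hh I) (S := {x |
      ((h : ℝ) * (h - 1) + 2 * L) / (h + 2 * L) / c ≤ x ∧
      x ≤ c * (((h : ℝ) * (h - 1) + 2 * L) / (h + 2 * L))}) (S' := {x |
      ((h : ℝ) * (h - 1) + 2 * L') / (h + 2 * L') / c ≤ x ∧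
      x ≤ c * (((h : ℝ) * (h - 1) + 2 * L') / (h + 2 * L'))}) (by
        refine Set.disjoint_left.2 fun x hx hx' => ?_
        -- The intervals are disjoint: `c ^ 2 ≤ R` cancels the factor `R` in the denominator `2 R
        -- n`, leaving half the clique's contribution plus `R n`. The term `R n` is below the other
        -- half by `hRa`.
        have h2 : c * (((h : ℝ) * (h - 1) + 2 * L') / (h + 2 * L')) <
            ((h : ℝ) * (h - 1) + 2 * L) / (h + 2 * L) / c := by
          have hd0 : 0 ≤ (h : ℝ) * (h - 1) := le_trans (by positivity) hhh
          rw [lt_div_iff₀ (by linarith), hLr, hLr']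
          calc c * (((h : ℝ) * (h - 1) + 2 * (R * n)) / (h + 2 * (R * n))) * c
              = c ^ 2 * (((h : ℝ) * (h - 1) + 2 * (R * n)) / (h + 2 * (R * n))) := by ring
            _ ≤ R * (((h : ℝ) * (h - 1) + 2 * (R * n)) / (0 + 2 * (R * n))) := by
                gcongr
                exact h.cast_nonneg
            _ = ((h : ℝ) * (h - 1) / 2 + R * n) / n := by
                field_simp
                ring
            _ < ((h : ℝ) * (h - 1) + 2 * L) / n := by
                refine div_lt_div_of_pos_right ?_ hn0
                have := L.cast_nonneg (α := ℝ)
                linarith [mul_pos (by linarith : (0 : ℝ) < R) ha3]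
        linarith [hx.1, hx'.2]) K
    by_contra! h5
    have h6 := (ENNReal.add_lt_add h5 h1).trans_le hdisj
    have h7 : (1 / 3 : ℝ≥0∞) + 2 / 3 = 1 := by
      rw [← ENNReal.toReal_eq_toReal_iff' (by finiteness) (by finiteness),
        ENNReal.toReal_add (by finiteness) (by finiteness)]
      norm_num
    rw [h7] at h6
    exact lt_irrefl _ h6

end LowerBound

end

theorem theorem1p3 :
    -- (a) upper bound: base model with random edge samples, `n` unknown
    (∃ (C : ℝ) (p : ℕ), 0 < C ∧ ∀ ε : ℝ, 0 < ε → ε < 1 →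
      ∃ A : QueryAlgorithm, A.InBaseModelWithRandEdge ∧ ∀ G : InputGraph,
        99 / 100 < A.probWithin G
            ⌊C * (1 + Real.log G.n) ^ p *
              (ε⁻¹ ^ 2 * min G.avgDeg (Real.sqrt (G.n / G.avgDeg)))⌋₊
            {x | |x - G.avgDeg| ≤ ε * G.avgDeg} ∧
        99 / 100 < A.probWithin G
            ⌊C * (1 + Real.log G.n) ^ p * (ε⁻¹ ^ 2 * (G.n : ℝ) ^ (1 / 3 : ℝ))⌋₊
            {x | |x - G.avgDeg| ≤ ε * G.avgDeg}) ∧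
    -- (b) lower bound: all queries, including full neighborhoods and random edges, `n` unknown
    (∀ c : ℝ, 1 ≤ c → ∃ (κ : ℝ) (n₀ : ℕ), 0 < κ ∧ ∀ A : QueryAlgorithm,
      (∀ G : InputGraph, 2 / 3 < A.prob G {x | G.avgDeg / c ≤ x ∧ x ≤ c * G.avgDeg}) →
      ∀ n : ℕ, n₀ ≤ n → ∃ G : InputGraph, G.n = n ∧
        A.probWithin G ⌊κ * (n : ℝ) ^ (1 / 3 : ℝ)⌋₊ Set.univ ≤ 3 / 4) := by
  exact ⟨upper_bound, lower_bound⟩
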